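/- **Setting.** Let $\mathfrak g$ be a simple complex Lie algebra of rank $N\ge 2$, $A=(a_{ij})_{i,j\in I}$, $I=\{0,1,\dots,N\}$, the Cartan matrix of the untwisted affine Lie algebra $\widehat{\mathfrak g}$ ($a_{ij}=\langle\alpha_j,h_i\rangle$), $d_i$ the coprime positive integers such that $b_{ij}=d_ia_{ij}$ is symmetric, and $a_i$ the coprime positive integers with $\sum_i a_i b_{ij}=0$. Put $m_{ij}=\delta_{i,j+1}-\delta_{i+1,j}$ (indices modulo $N+1$) if $\mathfrak g=A_N$, and $m_{ij}=0$ otherwise. Let $q,\kappa\in\mathbb C^\times$ be generic, i.e. $q^m\kappa^n=1$ with $m,n\in\mathbb Z$ only for $m=n=0$; powers $q^x$, $x\in\mathbb C$, are taken for the principal logarithm of $q$. Put $q_i=q^{d_i}$, $[n]=\frac{q^n-q^{-n}}{q-q^{-1}}$, and let $[n]_i$, $\left[{a\atop r}\right]_i$ be the $q_i$-integers and $q_i$-binomial coefficients. The quantum toroidal algebra $U=U_{q,\kappa}(\mathfrak g_{tor})$ is the unital $\mathbb C$-algebra with generators $a^\vee_{i,l}$, $X^\pm_{i,n}$, $k_i^{\pm1}$,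 $q^{\pm c/2}$, $q^{\pm d}$ ($i\in I$, $l\in\mathbb Z\setminus\{0\}$, $n\in\mathbb Z$) and the following relations, where $X_i^\pm(z)=\sum_n X^\pm_{i,n}z^{-n}$, $\Phi_i^\pm(z)=k_i^{\pm1}\exp\bigl(\pm(q_i-q_i^{-1})\sum_{n>0}a^\vee_{i,\pm n}z^{\mp n}\bigr)$ and $\delta(z)=\sum_{n\in\mathbb Z} z^n$: the elements $k_i^{\pm1}$, $q^{\pm c/2}$, $q^{\pm d}$ are mutually inverse pairs; $q^{\pm c/2}$ and $\prod_i k_i^{a_i}$ are central; $[k_i,k_j]=[k_i,a^\vee_{j,l}]=[q^d,k_i]=0$; $q^da^\vee_{i,l}q^{-d}=q^la^\vee_{i,l}$; $q^dX^\pm_{i,n}q^{-d}=q^nX^\pm_{i,n}$; $k_iX_j^\pm(z)k_i^{-1}=q^{\pm b_{ij}}X^\pm_j(z)$; $$[a^\vee_{i,l},a^\vee_{j,m}]=\delta_{l+m,0}\frac{[a_{ij}l]_i}{l}\,\frac{q^{lc}-q^{-lc}}{q_j-q_j^{-1}}\,\kappa^{-lm_{ij}},\qquad [a^\vee_{i,l},X_j^\pm(z)]=\pm\frac{[a_{ij}l]_i}{l}\,q^{\mp|l|c/2}\,\kappa^{-lm_{ij}}z^lX_j^\pm(z),$$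 $$(\kappa^{m_{ij}}z-q^{\pm b_{ij}}w)X_i^\pm(z)X_j^\pm(w)=(\kappa^{m_{ij}}q^{\pm b_{ij}}z-w)X_j^\pm(w)X_i^\pm(z),$$ $$[X_i^+(z),X_j^-(w)]=\frac{\delta_{ij}}{q_i-q_i^{-1}}\Bigl(\delta\bigl(q^c\tfrac wz\bigr)\Phi_i^+(q^{c/2}w)-\delta\bigl(q^c\tfrac zw\bigr)\Phi_i^-(q^{c/2}z)\Bigr),$$ and, for $i\ne j$ and $a=1-a_{ij}$, $$\sum_{\sigma\in\mathfrak S_a}\sum_{r=0}^a(-1)^r\left[{a\atop r}\right]_iX_i^\pm(z_{\sigma(1)})\cdots X_i^\pm(z_{\sigma(r)})\,X_j^\pm(w)\,X_i^\pm(z_{\sigma(r+1)})\cdots X_i^\pm(z_{\sigma(a)})=0 .$$ Let $k,l\in\mathbb C$ with $q^{2k}$ not a root of unity (so $k\neq0$; this holds for instance if $|q^{2k}|<1$). Let $\mathfrak C_{k,l}$ be the category of the $U$-modules $V$ such that (i) $q^{c/2}$ and $\prod_ik_i^{a_i}$ act on $V$ as $q^{k/2}$ and $q^{-l}$; (ii)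 $V$ is the direct sum of the different spaces among the $V_\omega=\{v\in V: q^dv=q^\omega v\}$, $\omega\in\mathbb C$; (iii) for every $\omega\in\mathbb C$ there is an $n_0$ with $V_{\omega+n}=0$ for all integers $n>n_0$. For $V\in\mathfrak C_{k,l}$ put $a_{i,m}=[d_i]a^\vee_{i,m}$ and define $Z_i^\pm(z)=\sum_{m\in\mathbb Z}Z^\pm_{i,m}z^{-m}$ by $$Z^\pm_i(z)=\exp\Bigl(\mp\sum_{m>0}\tfrac{q^{\mp km/2}(q-q^{-1})}{q^{km}-q^{-km}}\,a_{i,-m}z^m\Bigr)\,X_i^\pm(z)\,\exp\Bigl(\pm\sum_{m>0}\tfrac{q^{\mp km/2}(q-q^{-1})}{q^{km}-q^{-km}}\,a_{i,m}z^{-m}\Bigr).$$ The quantum $Z$-algebra $Z_V$ of $V$ is the algebra of operators on $V$ generated by all $Z^\pm_{i,m}$, $k_i^{\pm1}$ and $q^d$. The corresponding $Z$-module is the vacuum space $\Omega_V=\{v\in V: a_{i,m}v=0\ \text{for all}\ i\in I,\ m>0\}$. **Theorem.** Let $V\in\mathfrak C_{k,l}$. Then the operators $Z^\pm_{i,m}$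 are well defined (the sums defining them have only finitely many non-zero terms on each vector), $\Omega_V$ is a $Z_V$-submodule of $V$, and $V$ is an irreducible $U_{q,\kappa}(\mathfrak g_{tor})$-module if and only if $\Omega_V$ is an irreducible $Z_V$-module. -/

import Mathlib

noncomputable section

namespace QToroidal

/-! ### Untwisted affine Dynkin diagrams -/

/-- The untwisted affine types `X_N^{(1)}`, `X_N` running over the types of simple complex Lie
algebras of rank at least two (`B_2 = C_2` and `A_3 = D_3` are listed once). -/
inductive AffineType : Type
  | A (N : ℕ) (h : 2 ≤ N)
  | B (N : ℕ) (h : 3 ≤ N)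
  | C (N : ℕ) (h : 2 ≤ N)
  | D (N : ℕ) (h : 4 ≤ N)
  | E6
  | E7
  | E8
  | F4
  | G2

namespace AffineType

/-- The rank `N` of the finite type. -/
def rank : AffineType → ℕ
  | A N _ => N
  | B N _ => N
  | C N _ => N
  | D N _ => N
  | E6 => 6
  | E7 => 7
  | E8 => 8
  | F4 => 4
  | G2 => 2

/-- The index set `I = {0, 1, …, N}`; the node `0` is the affine node. -/
abbrev Node (X : AffineType) : Type := Fin (X.rank + 1)

/-- The edges of the affine Dynkin diagram, each listed in one direction. The finite nodes
of the exceptional types `E` are numbered as in Bourbaki. -/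
def edge : AffineType → ℕ → ℕ → Prop
  | A N _ => fun i j => j = i + 1 ∨ (i = 0 ∧ j = N)
  | B _ _ => fun i j => (i = 0 ∧ j = 2) ∨ (1 ≤ i ∧ j = i + 1)
  | C _ _ => fun i j => j = i + 1
  | D N _ => fun i j =>
      (i = 0 ∧ j = 2) ∨ (1 ≤ i ∧ j = i + 1 ∧ j + 1 ≤ N) ∨ (i + 2 = N ∧ j = N)
  | E6 => fun i j => (i, j) ∈ [(1, 3), (3, 4), (4, 5), (5, 6), (2, 4), (0, 2)]
  | E7 => fun i j => (i, j) ∈ [(1, 3), (3, 4), (4, 5), (5, 6), (6, 7), (2, 4), (0, 1)]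
  | E8 => fun i j => (i, j) ∈ [(1, 3), (3, 4), (4, 5), (5, 6), (6, 7), (7, 8), (2, 4), (0, 8)]
  | F4 => fun i j => j = i + 1
  | G2 => fun i j => j = i + 1

instance (X : AffineType) (i j : ℕ) : Decidable (X.edge i j) := by
  cases X <;> unfold edge <;> infer_instance

/-- The coprime positive integers `d_i` symmetrizing the Cartan matrix. -/
def d (X : AffineType) (i : X.Node) : ℕ :=
  match X with
  | B N _ => if i.val = N then 1 else 2
  | C N _ => if i.val = 0 ∨ i.val = N then 2 else 1
  | F4 => if i.val ≤ 2 then 2 else 1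
  | G2 => if i.val ≤ 1 then 3 else 1
  | _ => 1

/-- The generalized Cartan matrix `a_{ij} = ⟨α_j, h_i⟩` (the division is exact). -/
def cartan (X : AffineType) (i j : X.Node) : ℤ :=
  if i = j then 2
  else if X.edge i j ∨ X.edge j i then -((max (X.d i) (X.d j) / X.d i : ℕ) : ℤ)
  else 0

/-- The symmetrized Cartan matrix `b_{ij} = d_i a_{ij}`. -/
def symm (X : AffineType) (i j : X.Node) : ℤ := (X.d i : ℤ) * X.cartan i j

/-- The labels of the affine diagram: the coprime positive integers `a_i` with
`∑_j a_{ij} a_j = 0`, equivalently `∑_i a_i b_{ij} = 0`. -/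
def label (X : AffineType) (i : X.Node) : ℕ :=
  match X with
  | A _ _ => 1
  | B _ _ => if i.val ≤ 1 then 1 else 2
  | C N _ => if i.val = 0 ∨ i.val = N then 1 else 2
  | D N _ => if i.val ≤ 1 ∨ N ≤ i.val + 1 then 1 else 2
  | E6 => [1, 1, 2, 2, 3, 2, 1].getD i.val 0
  | E7 => [1, 2, 2, 3, 4, 3, 2, 1].getD i.val 0
  | E8 => [1, 2, 3, 4, 6, 5, 4, 3, 2].getD i.val 0
  | F4 => [1, 2, 3, 4, 2].getD i.val 0
  | G2 => [1, 2, 3].getD i.val 0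

/-- The matrix `m_{ij}`: `δ_{i,j+1} - δ_{i+1,j}` in type `A_N`, the indices being read modulo
`N + 1` (addition in `Fin (N + 1)`), and `0` in the other types. -/
def kExp (X : AffineType) (i j : X.Node) : ℤ :=
  match X with
  | A _ _ => (if i = j + 1 then 1 else 0) - (if i + 1 = j then 1 else 0)
  | _ => 0

end AffineType

/-! ### `q`-numbers and formal exponentials -/

/-- `[n] = (q^n - q^{-n}) / (q - q^{-1})`. -/
def qint (q : ℂ) (n : ℤ) : ℂ := (q ^ n - q ^ (-n)) / (q - q⁻¹)

/-- `[n]! = [n] ⋯ [1]`. -/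
def qfact (q : ℂ) (n : ℕ) : ℂ := ∏ t ∈ Finset.range n, qint q ((t : ℤ) + 1)

/-- The `q`-binomial coefficient `[n]! / ([n-r]! [r]!)`, for `r ≤ n`. -/
def qbinom (q : ℂ) (n r : ℕ) : ℂ := qfact q n / (qfact q (n - r) * qfact q r)

/-- The coefficient of `t^n` in `exp (∑_{m ≥ 1} c_m t^m) = ∑_r (∑_{m ≥ 1} c_m t^m)^r / r!`. The
powers with `r > n` do not contribute. -/
def expCoeff {R : Type*} [Ring R] [Algebra ℂ R] (c : ℕ → R) (n : ℕ) : R :=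
  ∑ r ∈ Finset.range (n + 1), ((Nat.factorial r : ℂ)⁻¹) •
    PowerSeries.coeff n ((PowerSeries.mk fun m => if m = 0 then 0 else c m) ^ r)

/-! ### The quantum toroidal algebra -/

/-- The generators: `a^∨_{i,l}` with `l ≠ 0`, `X^±_{i,n}` (with `ε = 1` for `X^+` and `ε = -1` for
`X^-`), `k_i^{±1}`, `q^{±c/2}` and `q^{±d}`. -/
inductive Gen (X : AffineType) : Type
  | a (i : X.Node) (l : ℤ) (hl : l ≠ 0)
  | x (ε : ℤˣ) (i : X.Node) (n : ℤ)
  | k (i : X.Node)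
  | kInv (i : X.Node)
  | qc
  | qcInv
  | qd
  | qdInv

section Free

variable (X : AffineType)

/-- The free algebra on the generators. -/
abbrev Free : Type := FreeAlgebra ℂ (Gen X)

variable {X}

/-- A generator as an element of the free algebra. -/
def gen (g : Gen X) : Free X := FreeAlgebra.ι ℂ g

/-- `a^∨_{i,l}`, with the value `0` at `l = 0`. -/
def aFree (i : X.Node) (l : ℤ) : Free X := if h : l ≠ 0 then gen (.a i l h) else 0

/-- `X^±_{i,n}`. -/
def xFree (ε : ℤˣ) (i : X.Node) (n : ℤ) : Free X := gen (.x ε i n)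

/-- `q^{n c / 2}` for an integer `n`. -/
def qcPow : ℤ → Free X
  | Int.ofNat n => gen .qc ^ n
  | Int.negSucc n => gen .qcInv ^ (n + 1)

/-- The central product of the `k_i`, each raised to the label of the node `i`. -/
def kCentral (X : AffineType) : Free X :=
  (List.ofFn fun i : X.Node => gen (.k i) ^ X.label i).prod

/-- For `n ≥ 0`, the coefficient of `z^{-n}` in
`Φ^+_i(z) = k_i exp ((q_i - q_i^{-1}) ∑_{m > 0} a^∨_{i,m} z^{-m})`; it is `0` for `n < 0`. -/
def phiPlus (q : ℂ) (i : X.Node) (n : ℤ) : Free X :=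
  if 0 ≤ n then
    gen (.k i) * expCoeff (fun m : ℕ =>
      (q ^ X.d i - (q ^ X.d i)⁻¹) • aFree i (m : ℤ)) n.toNat
  else 0

/-- For `n ≤ 0`, the coefficient of `z^{-n}` in
`Φ^-_i(z) = k_i^{-1} exp (-(q_i - q_i^{-1}) ∑_{m > 0} a^∨_{i,-m} z^m)`; it is `0` for `n > 0`. -/
def phiMinus (q : ℂ) (i : X.Node) (n : ℤ) : Free X :=
  if n ≤ 0 then
    gen (.kInv i) * expCoeff (fun m : ℕ =>
      (-(q ^ X.d i - (q ^ X.d i)⁻¹)) • aFree i (-(m : ℤ))) (-n).toNat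
  else 0

/-- `X_{i,n(1)} ⋯ X_{i,n(r)} X_{j,s} X_{i,n(r+1)} ⋯ X_{i,n(a)}`. -/
def serreWord (ε : ℤˣ) (i j : X.Node) {a : ℕ} (n : Fin a → ℤ) (s : ℤ) (r : ℕ) : Free X :=
  ((List.ofFn fun t => xFree ε i (n t)).take r).prod * xFree ε j s *
    ((List.ofFn fun t => xFree ε i (n t)).drop r).prod

/-- The exponent `a = 1 - a_{ij}` in the Serre relation of `i ≠ j`. -/
def serreExp (i j : X.Node) : ℕ := (1 - X.cartan i j).toNat

end Free

/-- The defining relations, each one being the family of the coefficients of the corresponding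
identity of currents; `X^±_i(z) = ∑_n X^±_{i,n} z^{-n}`. Relations for `X^+` and `X^-` are
written together with the help of the sign `ε`. -/
inductive Rel (X : AffineType) (q κ : ℂ) : Free X → Free X → Prop
  | k_kInv (i : X.Node) : Rel X q κ (gen (.k i) * gen (.kInv i)) 1
  | kInv_k (i : X.Node) : Rel X q κ (gen (.kInv i) * gen (.k i)) 1
  | qc_qcInv : Rel X q κ (gen .qc * gen .qcInv) 1
  | qcInv_qc : Rel X q κ (gen .qcInv * gen .qc) 1
  | qd_qdInv : Rel X q κ (gen .qd * gen .qdInv) 1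
  | qdInv_qd : Rel X q κ (gen .qdInv * gen .qd) 1
  | qc_central (g : Gen X) : Rel X q κ (gen .qc * gen g) (gen g * gen .qc)
  | k_central (g : Gen X) : Rel X q κ (kCentral X * gen g) (gen g * kCentral X)
  | k_k (i j : X.Node) : Rel X q κ (gen (.k i) * gen (.k j)) (gen (.k j) * gen (.k i))
  | k_a (i j : X.Node) (l : ℤ) : Rel X q κ (gen (.k i) * aFree j l) (aFree j l * gen (.k i))
  | qd_k (i : X.Node) : Rel X q κ (gen .qd * gen (.k i)) (gen (.k i) * gen .qd)
  | qd_a (i : X.Node) (l : ℤ) :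
      Rel X q κ (gen .qd * aFree i l) (q ^ l • (aFree i l * gen .qd))
  | qd_x (ε : ℤˣ) (i : X.Node) (n : ℤ) :
      Rel X q κ (gen .qd * xFree ε i n) (q ^ n • (xFree ε i n * gen .qd))
  /-- `k_i X^±_j(z) k_i^{-1} = q_i^{± a_{ij}} X^±_j(z)`. -/
  | k_x (ε : ℤˣ) (i j : X.Node) (n : ℤ) :
      Rel X q κ (gen (.k i) * xFree ε j n)
        (q ^ ((ε : ℤ) * X.symm i j) • (xFree ε j n * gen (.k i)))
  /-- `[a^∨_{i,l}, a^∨_{j,m}] = δ_{l+m,0} ([a_{ij} l]_i / l)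
  ((q^{lc} - q^{-lc}) / (q_j - q_j^{-1})) κ^{-l m_{ij}}`. -/
  | a_a (i j : X.Node) (l m : ℤ) (hl : l ≠ 0) (hm : m ≠ 0) :
      Rel X q κ (aFree i l * aFree j m - aFree j m * aFree i l)
        (if l + m = 0 then
          (qint (q ^ X.d i) (X.cartan i j * l) / l * κ ^ (-l * X.kExp i j) /
            (q ^ X.d j - (q ^ X.d j)⁻¹)) • (qcPow (2 * l) - qcPow (-(2 * l)))
        else 0)
  /-- `[a^∨_{i,l}, X^±_j(z)] = ± ([a_{ij} l]_i / l) q^{∓|l|c/2} κ^{-l m_{ij}} z^l X^±_j(z)`. -/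
  | a_x (ε : ℤˣ) (i j : X.Node) (l n : ℤ) (hl : l ≠ 0) :
      Rel X q κ (aFree i l * xFree ε j n - xFree ε j n * aFree i l)
        ((((ε : ℤ) : ℂ) * (qint (q ^ X.d i) (X.cartan i j * l) / l) * κ ^ (-l * X.kExp i j)) •
          (qcPow (-((ε : ℤ) * |l|)) * xFree ε j (n + l)))
  /-- `(κ^{m_{ij}} z - q^{± b_{ij}} w) X^±_i(z) X^±_j(w)
  = (κ^{m_{ij}} q^{± b_{ij}} z - w) X^±_j(w) X^±_i(z)`. -/
  | x_x (ε : ℤˣ) (i j : X.Node) (r s : ℤ) :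
      Rel X q κ
        (κ ^ X.kExp i j • (xFree ε i (r + 1) * xFree ε j s) -
          q ^ ((ε : ℤ) * X.symm i j) • (xFree ε i r * xFree ε j (s + 1)))
        ((κ ^ X.kExp i j * q ^ ((ε : ℤ) * X.symm i j)) • (xFree ε j s * xFree ε i (r + 1)) -
          xFree ε j (s + 1) * xFree ε i r)
  /-- `[X^+_i(z), X^-_j(w)] = (δ_{ij} / (q_i - q_i^{-1}))
  (δ(q^c w/z) Φ^+_i(q^{c/2} w) - δ(q^c z/w) Φ^-_i(q^{c/2} z))`. -/
  | x_y (i j : X.Node) (r s : ℤ) :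
      Rel X q κ (xFree 1 i r * xFree (-1) j s - xFree (-1) j s * xFree 1 i r)
        (if i = j then
          (q ^ X.d i - (q ^ X.d i)⁻¹)⁻¹ •
            (qcPow (r - s) * phiPlus q i (r + s) - qcPow (s - r) * phiMinus q i (r + s))
        else 0)
  /-- The Serre relations, with `a = 1 - a_{ij}`:
  `∑_σ ∑_r (-1)^r [a choose r]_i X^±_i(z_{σ(1)}) ⋯ X^±_i(z_{σ(r)}) X^±_j(w)
  X^±_i(z_{σ(r+1)}) ⋯ X^±_i(z_{σ(a)}) = 0`. -/
  | serre (ε : ℤˣ) (i j : X.Node) (hij : i ≠ j) (n : Fin (serreExp i j) → ℤ) (s : ℤ) :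
      Rel X q κ
        (∑ σ : Equiv.Perm (Fin (serreExp i j)), ∑ r ∈ Finset.range (serreExp i j + 1),
          ((-1) ^ r * qbinom (q ^ X.d i) (serreExp i j) r) •
            serreWord ε i j (fun t => n (σ t)) s r)
        0

/-- The quantum toroidal algebra `U_{q,κ}(g_tor)`. -/
abbrev U (X : AffineType) (q κ : ℂ) : Type := RingQuot (Rel X q κ)

/-! ### Modules of level `(k, l)` -/

section Modules

variable (X : AffineType) (q κ k l : ℂ) (V : Type*) [AddCommGroup V] [Module ℂ V]
  [Module (U X q κ) V] [IsScalarTower ℂ (U X q κ) V]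

/-- The operator by which (the class of) an element of the free algebra acts on `V`. -/
def act : Free X →ₐ[ℂ] Module.End ℂ V :=
  (Algebra.lsmul ℂ ℂ V : U X q κ →ₐ[ℂ] Module.End ℂ V).comp (RingQuot.mkAlgHom ℂ (Rel X q κ))

/-- The space `V_ω = {v | q^d v = q^ω v}`. -/
def degreeSpace (ω : ℂ) : Submodule ℂ V :=
  Module.End.eigenspace (act X q κ V (gen .qd)) (q ^ ω)

/-- The objects of the category `C_{k,l}`: `q^{c/2}` acts as `q^{k/2}` and the central product of
the `k_i` as `q^{-l}`; `V` is the (automatically direct) sum of the spaces `V_ω`; and for every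
`ω` the spaces `V_{ω+n}`, `n ∈ ℕ`, vanish from some `n` on. -/
structure InCategory : Prop where
  level_c : act X q κ V (gen .qc) = q ^ (k / 2) • (1 : Module.End ℂ V)
  level_k : act X q κ V (kCentral X) = q ^ (-l) • (1 : Module.End ℂ V)
  graded : ⨆ ω : ℂ, degreeSpace X q κ V ω = ⊤
  truncated : ∀ ω : ℂ, ∃ n₀ : ℕ, ∀ n : ℕ, n₀ < n → degreeSpace X q κ V (ω + n) = ⊥

/-! ### The quantum `Z`-algebra of a module -/

/-- The operator of `a_{i,m} = [d_i] a^∨_{i,m}` on `V`. -/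
def aOp (i : X.Node) (m : ℤ) : Module.End ℂ V :=
  qint q (X.d i) • act X q κ V (aFree i m)

variable {V} in
/-- The pointwise sum of a family of operators of which, on each vector, only finitely many do
not vanish (and `0` for any other family). -/
def locSum {ι : Type*} (f : ι → Module.End ℂ V) : Module.End ℂ V :=
  open Classical in
  if h : ∀ v : V, {p | f p v ≠ 0}.Finite then
    { toFun := fun v => ∑ᶠ p, f p v
      map_add' := fun v w => by
        simp only [map_add]
        exact finsum_add_distrib (h v) (h w)
      map_smul' := fun c v => by
        simp only [map_smul, RingHom.id_apply]
        exact (smul_finsum' c (h v)).symm }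
  else 0

/-- `± q^{∓km/2} (q - q^{-1}) / (q^{km} - q^{-km})`. -/
def zCoeff (ε : ℤˣ) (m : ℕ) : ℂ :=
  ((ε : ℤ) : ℂ) * q ^ (-((ε : ℤ) : ℂ) * k * m / 2) *
    ((q - q⁻¹) / (q ^ (k * m) - q ^ (-(k * m))))

/-- The coefficient of `z^r` in
`exp (∓ ∑_{m > 0} q^{∓km/2} (q - q^{-1}) / (q^{km} - q^{-km}) a_{i,-m} z^m)`. -/
def eMinus (ε : ℤˣ) (i : X.Node) (r : ℕ) : Module.End ℂ V :=
  expCoeff (fun m : ℕ => (-zCoeff q k ε m) • aOp X q κ V i (-(m : ℤ))) r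

/-- The coefficient of `z^{-s}` in
`exp (± ∑_{m > 0} q^{∓km/2} (q - q^{-1}) / (q^{km} - q^{-km}) a_{i,m} z^{-m})`. -/
def ePlus (ε : ℤˣ) (i : X.Node) (s : ℕ) : Module.End ℂ V :=
  expCoeff (fun m : ℕ => zCoeff q k ε m • aOp X q κ V i (m : ℤ)) s

/-- The contribution to the coefficient of `z^{-m}` of the product of the two exponentials with
the current `X^±_i(z)` between them which comes from `z^r` in the first exponential and `z^{-s}`
in the second. -/
def zTerm (ε : ℤˣ) (i : X.Node) (m : ℤ) (p : ℕ × ℕ) : Module.End ℂ V :=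
  eMinus X q κ k V ε i p.1 * act X q κ V (xFree ε i (m + p.1 - p.2)) * ePlus X q κ k V ε i p.2

/-- The operator `Z^±_{i,m}(V)`. -/
def zOp (ε : ℤˣ) (i : X.Node) (m : ℤ) : Module.End ℂ V :=
  locSum (zTerm X q κ k V ε i m)

/-- The quantum `Z`-algebra of `V`: the algebra of operators on `V` generated by the
`Z^±_{i,m}(V)`, the `k_i^{±1}` and `q^d`. -/
def zAlgebra : Subalgebra ℂ (Module.End ℂ V) :=
  Algebra.adjoin ℂ
    ({T | ∃ (ε : ℤˣ) (i : X.Node) (m : ℤ), T = zOp X q κ k V ε i m} ∪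
      {T | ∃ i : X.Node, T = act X q κ V (gen (.k i)) ∨ T = act X q κ V (gen (.kInv i))} ∪
      {act X q κ V (gen .qd)})

/-- The vacuum space `Ω_V = {v | a_{i,m} v = 0 for all i and all m > 0}`. -/
def vacuumSpace : Submodule ℂ V :=
  ⨅ (i : X.Node) (m : ℤ) (_ : 0 < m), LinearMap.ker (aOp X q κ V i m)

end Modules

end QToroidal

end

namespace QToroidal

/-! ### Coefficients of formal exponentials -/

section ExpCoeff

/-! At level `k` the operators a_{i,m} satisfy Heisenberg relations. The coefficients in the two
exponentials of Z_j^±(z) are exactly those for which the commutator of a_{i,n} with an exponential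
cancels its commutator with X_j^±(z). Hence every Z^±_{j,m} commutes with every a_{i,n} (`aOp_zOp`),
and the vacuum space Ω is stable under Z_V. Conversely the X^±_{i,n} can be recovered from the
Z^±_{i,m} and the a_{i,n}, because the leading term of Z^±_{i,n} is X^±_{i,n} and the grading is
truncated (`x_mem_of_zOp_mem`). So the U-submodules are the subspaces stable under Z_V and the
Heisenberg operators.

The Heisenberg relations are nondegenerate. The matrix of the commutators [a_{i,n}, a_{j,-n}] is, up
to a nonzero scalar, a quantized affine Cartan matrix with parameters q^n, κ^n. The affine Cartan
matrix itself is singular, but its quantization has trivial kernel at generic parameters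
(`kernelTrivial_of_generic`, checked type by type). A change of basis among the positive modes then
gives canonical pairs, so V is a module over a Weyl algebra whose annihilation operators are locally
nilpotent. Such a module is generated from its vacuum vectors by the creation operators
(`eq_top_of_vacuum_le`), and no nonzero vacuum vector lies in the sum of the images of the creation
operators (`eq_zero_of_vacuum_of_mem_iSup_range`).

If V is irreducible and W is a nonzero Z_V-submodule of Ω, the creation operators applied to W span
a U-submodule, hence all of V, and this forces W = Ω. If Ω is irreducible, a nonzero U-submodule N
of V has a nonzero vacuum vector (`exists_vacuum_mem`: vectors of top degree are killed by the
positive modes), so N contains Ω and is V. -/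

theorem coeff_pow_of_lt {R : Type*} [Ring R] (c : ℕ → R) {n r : ℕ} (h : n < r) :
    PowerSeries.coeff n ((PowerSeries.mk fun m => if m = 0 then 0 else c m) ^ r) = 0 := by
  induction r generalizing n with
  | zero => omega
  | succ r ih =>
    rw [pow_succ, PowerSeries.coeff_mul]
    refine Finset.sum_eq_zero fun p hp => ?_
    rw [PowerSeries.coeff_mk]
    split_ifs with h0
    · rw [mul_zero]
    · rw [ih, zero_mul]
      have := Finset.HasAntidiagonal.mem_antidiagonal.mp hp
      omega

variable {R : Type*} [Ring R] [Algebra ℂ R]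

theorem coeff_pow_mem (P : ℕ → Submodule ℂ R) (h1 : 1 ∈ P 0)
    (hmul : ∀ m n x y, x ∈ P m → y ∈ P n → x * y ∈ P (m + n)) {f : PowerSeries R}
    (hf : ∀ m, PowerSeries.coeff m f ∈ P m) (r n : ℕ) :
    PowerSeries.coeff n (f ^ r) ∈ P n := by
  induction r generalizing n with
  | zero =>
    rw [pow_zero, PowerSeries.coeff_one]
    split_ifs with h
    · rw [h]; exact h1
    · exact zero_mem _
  | succ r ih =>
    rw [pow_succ, PowerSeries.coeff_mul]
    refine Submodule.sum_mem _ fun p hp => ?_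
    rw [← Finset.HasAntidiagonal.mem_antidiagonal.mp hp]
    exact hmul _ _ _ _ (ih _) (hf _)

/-- The coefficients of a formal exponential respect a multiplicative grading. -/
theorem expCoeff_mem (P : ℕ → Submodule ℂ R) (h1 : 1 ∈ P 0)
    (hmul : ∀ m n x y, x ∈ P m → y ∈ P n → x * y ∈ P (m + n)) {c : ℕ → R}
    (hc : ∀ m, 0 < m → c m ∈ P m) (n : ℕ) : expCoeff c n ∈ P n := by
  refine Submodule.sum_mem _ fun r _ => Submodule.smul_mem _ _ ?_
  refine coeff_pow_mem P h1 hmul (fun m => ?_) r n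
  rw [PowerSeries.coeff_mk]
  split_ifs with h
  · exact zero_mem _
  · exact hc m (Nat.pos_of_ne_zero h)

theorem expCoeff_mem_subalgebra (S : Subalgebra ℂ R) {c : ℕ → R}
    (hc : ∀ m, 0 < m → c m ∈ S) (n : ℕ) : expCoeff c n ∈ S :=
  expCoeff_mem (fun _ => Subalgebra.toSubmodule S) S.one_mem
    (fun _ _ _ _ hx hy => S.mul_mem hx hy) hc n

@[simp]
theorem expCoeff_zero (c : ℕ → R) : expCoeff c 0 = 1 := by
  simp [expCoeff]

/-- The extra powers start in degree above `n`. This freedom in the upper limit allows coefficients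
of different degrees to be compared term by term. -/
theorem expCoeff_eq_sum_range (c : ℕ → R) {n N : ℕ} (h : n < N) :
    expCoeff c n = ∑ r ∈ Finset.range N, ((Nat.factorial r : ℂ)⁻¹) •
      PowerSeries.coeff n ((PowerSeries.mk fun m => if m = 0 then 0 else c m) ^ r) := by
  refine Finset.sum_subset (Finset.range_subset_range.mpr h) fun r _ hr => ?_
  rw [coeff_pow_of_lt, smul_zero]
  simpa using hr

theorem mul_pow_of_commutator {S : Type*} [Ring S] {x y z : S} (hxy : x * y = y * x + z)
    (hz : Commute z y) (r : ℕ) : x * y ^ (r + 1) = y ^ (r + 1) * x + (r + 1) • (z * y ^ r) := by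
  induction r with
  | zero => simp [hxy]
  | succ r ih =>
    rw [pow_succ, ← mul_assoc, ih, add_mul, mul_assoc _ x y, hxy, mul_add, ← mul_assoc,
      ← (hz.pow_right (r + 1)).eq, smul_mul_assoc, mul_assoc z, ← pow_succ y r,
      succ_nsmul _ (r + 1)]
    abel

/-- If `a` has a central commutator with the `l`-th coefficient of the exponent and commutes with
the others, its commutator with the formal exponential is a shift. -/
theorem mul_expCoeff_of_commutator {a : R} {c : ℕ → R} {l : ℕ} (hl : 0 < l) {γ : ℂ}
    (hc : ∀ m, 0 < m → a * c m = c m * a + if m = l then algebraMap ℂ R γ else 0) (n : ℕ) :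
    a * expCoeff c n = expCoeff c n * a + if l ≤ n then γ • expCoeff c (n - l) else 0 := by
  set C : PowerSeries R := PowerSeries.mk fun m => if m = 0 then 0 else c m with hC
  have hz (f : PowerSeries R) : PowerSeries.C (algebraMap ℂ R γ) * PowerSeries.X ^ l * f =
      f * (PowerSeries.C (algebraMap ℂ R γ) * PowerSeries.X ^ l) := by
    ext m
    rw [mul_assoc, ← (PowerSeries.commute_X_pow f l).eq, ← mul_assoc f,
      PowerSeries.coeff_C_mul, PowerSeries.coeff_mul_X_pow', PowerSeries.coeff_mul_X_pow']
    split_ifs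
    · rw [PowerSeries.coeff_mul_C, Algebra.commutes]
    · simp
  have hcomm : PowerSeries.C a * C = C * PowerSeries.C a +
      PowerSeries.C (algebraMap ℂ R γ) * PowerSeries.X ^ l := by
    ext m
    rw [map_add, PowerSeries.coeff_C_mul, PowerSeries.coeff_mul_C, PowerSeries.coeff_C_mul,
      PowerSeries.coeff_X_pow, hC, PowerSeries.coeff_mk]
    rcases Nat.eq_zero_or_pos m with rfl | hm
    · simp [hl.ne]
    · rw [if_neg hm.ne', hc m hm]
      split_ifs <;> simp
  -- The commutator γ t^l of `a` with the exponent `C` is central for `C`, so commuting with `a`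
  -- acts on powers of `C` as a derivation.
  have key (r : ℕ) : a * PowerSeries.coeff n (C ^ (r + 1)) =
      PowerSeries.coeff n (C ^ (r + 1)) * a +
        if l ≤ n then (r + 1) • γ • PowerSeries.coeff (n - l) (C ^ r) else 0 := by
    have h := congrArg (PowerSeries.coeff n)
      (mul_pow_of_commutator hcomm (hz C) r)
    rw [PowerSeries.coeff_C_mul, map_add, PowerSeries.coeff_mul_C] at h
    rw [h, hz, ← mul_assoc, map_nsmul, PowerSeries.coeff_mul_X_pow', PowerSeries.coeff_mul_C]
    split_ifs
    · rw [← Algebra.commutes, ← Algebra.smul_def]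
    · simp
  have hfac (r : ℕ) : ((Nat.factorial (r + 1) : ℂ)⁻¹) * ((r + 1 : ℕ) : ℂ) =
      (Nat.factorial r : ℂ)⁻¹ := by
    have h1 : (Nat.factorial r : ℂ) ≠ 0 := by exact_mod_cast Nat.factorial_ne_zero r
    have h2 : ((r + 1 : ℕ) : ℂ) ≠ 0 := by exact_mod_cast Nat.succ_ne_zero r
    rw [Nat.factorial_succ, Nat.cast_mul]
    field_simp
  -- One spare term: splitting off r = 0, which commutes with `a`, leaves n + 1 terms. The factor r
  -- + 1 from the derivation turns 1/(r+1)! into 1/r!.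
  rw [expCoeff_eq_sum_range c (show n < n + 1 + 1 by omega), Finset.sum_range_succ']
  simp only [← hC, pow_zero, Nat.factorial_zero, Nat.cast_one, inv_one, one_smul, mul_add,
    add_mul, Finset.mul_sum, Finset.sum_mul, mul_smul_comm, smul_mul_assoc, key, smul_add,
    Finset.sum_add_distrib]
  have hone : a * PowerSeries.coeff n (1 : PowerSeries R) =
      PowerSeries.coeff n (1 : PowerSeries R) * a := by
    rw [PowerSeries.coeff_one]; split_ifs <;> simp
  rw [hone, add_right_comm]
  congr 1
  split_ifs with hln
  · rw [expCoeff_eq_sum_range c (show n - l < n + 1 by omega), Finset.smul_sum]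
    refine Finset.sum_congr rfl fun r _ => ?_
    rw [← Nat.cast_smul_eq_nsmul ℂ, smul_smul, smul_smul, hfac, ← hC, smul_smul, mul_comm]
  · simp

end ExpCoeff

/-! ### Representations of the Heisenberg relations -/

section Heisenberg

variable {V : Type*} [AddCommGroup V] [Module ℂ V]

/-- The Weyl algebra identity b^n a = a b^n + n b^(n-1). At n = 0 the truncated exponent is
harmless, its coefficient being 0. -/
theorem apply_pow_of_commutator {b a : Module.End ℂ V} (h : b * a = a * b + 1) (n : ℕ) (v : V) :
    (b ^ n) (a v) = a ((b ^ n) v) + n • (b ^ (n - 1)) v := by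
  induction n with
  | zero => simp
  | succ n ih =>
    have h' (w : V) : b (a w) = a (b w) + w := by
      simpa using LinearMap.congr_fun h w
    rw [pow_succ', Module.End.mul_apply, ih, map_add, h', map_nsmul, Module.End.mul_apply,
      Nat.add_sub_cancel, succ_nsmul]
    rcases n with _ | n
    · simp
    · rw [Nat.add_sub_cancel, pow_succ' b n, Module.End.mul_apply]
      abel

/-- If `b` lowers and `a` raises, `v - n⁻¹ a b v` is killed by a smaller power of `b` than `v`. -/
theorem pow_apply_sub_smul {b a : Module.End ℂ V} (h : b * a = a * b + 1) {n : ℕ} (hn : 0 < n)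
    {v : V} (hv : (b ^ (n + 1)) v = 0) : (b ^ n) (v - (n : ℂ)⁻¹ • a (b v)) = 0 := by
  have h1 : (b ^ n) (b v) = 0 := by rwa [← Module.End.mul_apply, ← pow_succ]
  have h2 : (b ^ (n - 1)) (b v) = (b ^ n) v := by
    rw [← Module.End.mul_apply, ← pow_succ, Nat.sub_add_cancel hn]
  rw [map_sub, map_smul, apply_pow_of_commutator h, h1, h2, map_zero, zero_add,
    ← Nat.cast_smul_eq_nsmul ℂ, smul_smul, inv_mul_cancel₀ (by exact_mod_cast hn.ne'), one_smul,
    sub_self]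

/-- Induction on the order of nilpotency: subtracting n⁻¹ a b v from v lowers the order and changes
v only by an element of the image of `a`. -/
theorem mem_ker_sup_range {b a : Module.End ℂ V} (h : b * a = a * b + 1) {n : ℕ} {v : V}
    (hv : (b ^ n) v = 0) : ∃ w u, b w = 0 ∧ v = w + a u := by
  induction n generalizing v with
  | zero => exact ⟨0, 0, by simp, by simpa using hv⟩
  | succ n ih =>
    rcases Nat.eq_zero_or_pos n with rfl | hn
    · exact ⟨v, 0, by simpa using hv, by simp⟩
    · obtain ⟨w, u, hw, hu⟩ := ih (pow_apply_sub_smul h hn hv)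
      refine ⟨w, u + (n : ℂ)⁻¹ • b v, hw, ?_⟩
      rw [map_add, map_smul, ← add_assoc, ← hu, sub_add_cancel]

/-- If b^(m+1) is the smallest power killing a nonzero v, then b^(m+1) a v = (m+1) b^m v is nonzero,
whereas b a v = 0 would make it vanish. -/
theorem eq_zero_of_apply_apply_eq_zero {b a : Module.End ℂ V} (h : b * a = a * b + 1) {v : V}
    (hv : ∃ n, (b ^ n) v = 0) (h0 : b (a v) = 0) : v = 0 := by
  classical
  by_contra hne
  obtain ⟨m, hm⟩ : ∃ m, Nat.find hv = m + 1 := by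
    refine Nat.exists_eq_succ_of_ne_zero fun hz => hne ?_
    have := Nat.find_spec hv
    rw [hz] at this
    simpa using this
  have h1 : (b ^ (m + 1)) v = 0 := hm ▸ Nat.find_spec hv
  have h2 := apply_pow_of_commutator h (m + 1) v
  rw [h1, map_zero, zero_add, pow_succ, Module.End.mul_apply, h0, map_zero, Nat.add_sub_cancel,
    ← Nat.cast_smul_eq_nsmul ℂ] at h2
  have h3 : (b ^ m) v = 0 := by
    rcases smul_eq_zero.mp h2.symm with h | h
    · exact absurd h (by exact_mod_cast Nat.succ_ne_zero m)
    · exact h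
  exact Nat.find_min hv (by omega) h3

variable {ι : Type*} {a b : ι → Module.End ℂ V}

/-- A subspace stable under the creation operators and containing the vacuum vectors is the whole
space. -/
theorem eq_top_of_vacuum_le (hbb : ∀ p p', Commute (b p) (b p'))
    (hba : ∀ p p', p ≠ p' → Commute (b p) (a p'))
    (hone : ∀ p, b p * a p = a p * b p + 1) (hnil : ∀ p v, ∃ n, (b p ^ n) v = 0)
    (hfin : ∀ v, {p | b p v ≠ 0}.Finite) {N : Submodule ℂ V}
    (hN : ∀ p, ∀ v ∈ N, a p v ∈ N) (hvac : ∀ v, (∀ p, b p v = 0) → v ∈ N) : N = ⊤ := by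
  classical
  -- Only finitely many annihilation operators act nontrivially on a given vector; the induction is
  -- on a finite set containing them.
  have key (S : Finset ι) : ∀ v, (∀ p ∉ S, b p v = 0) → v ∈ N := by
    induction S using Finset.induction_on with
    | empty => exact fun v hv => hvac v fun p => hv p (by simp)
    | insert p S hp ih =>
      -- Inner induction on the power of `b p` killing v. Both v - n⁻¹ a b v and b v are killed by a
      -- smaller power, and v is recovered from them by one application of `a p`.
      suffices H : ∀ n v, (b p ^ n) v = 0 → (∀ p' ∉ insert p S, b p' v = 0) → v ∈ N by
        intro v hv
        obtain ⟨n, hn⟩ := hnil p v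
        exact H n v hn hv
      intro n
      induction n with
      | zero =>
        intro v hv _
        rw [pow_zero, Module.End.one_apply] at hv
        rw [hv]; exact N.zero_mem
      | succ n ihn =>
        intro v hv hv'
        rcases Nat.eq_zero_or_pos n with rfl | hn
        · refine ih v fun p' hp' => ?_
          by_cases h : p' = p
          · rw [h]; simpa using hv
          · exact hv' p' (by simp [h, hp'])
        · have hb (p') (hp' : p' ∉ insert p S) : b p' (b p v) = 0 := by
            rw [← Module.End.mul_apply, (hbb p' p).eq, Module.End.mul_apply, hv' p' hp', map_zero]
          have hbv : b p v ∈ N := by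
            refine ihn _ ?_ hb
            rwa [← Module.End.mul_apply, ← pow_succ]
          have h1 : v - (n : ℂ)⁻¹ • a p (b p v) ∈ N := by
            refine ihn _ (pow_apply_sub_smul (hone p) hn hv) fun p' hp' => ?_
            have hne : p' ≠ p := fun h => hp' (by simp [h])
            rw [map_sub, map_smul, hv' p' hp', ← Module.End.mul_apply (b p'), (hba p' p hne).eq,
              Module.End.mul_apply, hb p' hp', map_zero, smul_zero, sub_zero]
          have h2 := N.add_mem h1 (N.smul_mem ((n : ℂ)⁻¹) (hN p _ hbv))
          rwa [sub_add_cancel] at h2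
  rw [eq_top_iff]
  intro v _
  exact key (hfin v).toFinset v fun p hp => by simpa using hp

/-- A vacuum vector in the image of the creation operators is zero. -/
theorem eq_zero_of_vacuum_of_mem_iSup_range (haa : ∀ p p', Commute (a p) (a p'))
    (hba : ∀ p p', p ≠ p' → Commute (b p) (a p'))
    (hone : ∀ p, b p * a p = a p * b p + 1) (hnil : ∀ p v, ∃ n, (b p ^ n) v = 0) {u : V}
    (hu : u ∈ ⨆ p, LinearMap.range (a p)) (hvac : ∀ p, b p u = 0) : u = 0 := by
  classical
  have key (S : Finset ι) : ∀ u ∈ ⨆ p ∈ S, LinearMap.range (a p),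
      (∀ p ∈ S, b p u = 0) → u = 0 := by
    induction S using Finset.induction_on with
    | empty => intro u hu _; simpa using hu
    | insert p S hp ih =>
      intro u hu hb
      -- Splitting v = w + a_p y with b_p w = 0 gives a_{p'} v = a_{p'} w + a_p a_{p'} y, and a_{p'}
      -- w is still killed by b_p.
      have hle : ⨆ p' ∈ S, LinearMap.range (a p') ≤ LinearMap.range (a p) ⊔
          (LinearMap.ker (b p) ⊓ ⨆ p' ∈ S, LinearMap.range (a p')) := by
        refine iSup₂_le fun p' hp' => ?_
        rintro _ ⟨v, rfl⟩
        have hne : p ≠ p' := fun h => hp (h ▸ hp')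
        obtain ⟨n, hn⟩ := hnil p v
        obtain ⟨w, y, hw, rfl⟩ := mem_ker_sup_range (hone p) hn
        rw [map_add, add_comm]
        refine Submodule.add_mem_sup ⟨a p' y, ?_⟩ ⟨?_, ?_⟩
        · rw [← Module.End.mul_apply, (haa p p').eq, Module.End.mul_apply]
        · change b p (a p' w) = 0
          rw [← Module.End.mul_apply, (hba p p' hne).eq, Module.End.mul_apply, hw, map_zero]
        · exact Submodule.mem_iSup_of_mem p' (Submodule.mem_iSup_of_mem hp' ⟨w, rfl⟩)
      rw [Finset.iSup_insert] at hu
      have hu' := (sup_le le_sup_left hle) hu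
      obtain ⟨_, ⟨v, rfl⟩, r, ⟨hr, hr'⟩, rfl⟩ := Submodule.mem_sup.mp hu'
      have hr0 : b p r = 0 := hr
      -- Applying b_p to u = a_p v + r leaves b_p a_p v = 0, hence v = 0, and the mode p drops out
      -- of u.
      have hbu := hb p (Finset.mem_insert_self p S)
      rw [map_add, hr0, add_zero] at hbu
      have hv := eq_zero_of_apply_apply_eq_zero (hone p) (hnil p v) hbu
      rw [hv, map_zero, zero_add] at hb ⊢
      exact ih r hr' fun p' hp' => hb p' (Finset.mem_insert_of_mem hp')
  obtain ⟨S, hS⟩ := Submodule.mem_iSup_iff_exists_finset.mp hu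
  exact key S u hS fun p _ => hvac p

end Heisenberg

/-! ### Invariant subspaces of diagonalizable operators -/

/-- Applying f - ν removes the eigenvector of eigenvalue ν from the sum and multiplies the others by
the nonzero scalars μ - ν. -/
theorem mem_of_sum_eigenvectors_mem {V : Type*} [AddCommGroup V] [Module ℂ V]
    {f : Module.End ℂ V} {N : Submodule ℂ V} (hN : ∀ v ∈ N, f v ∈ N) (S : Finset ℂ)
    (x : ℂ → V) (hx : ∀ μ ∈ S, f (x μ) = μ • x μ) (hsum : ∑ μ ∈ S, x μ ∈ N) :
    ∀ μ ∈ S, x μ ∈ N := by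
  classical
  induction S using Finset.induction_on generalizing x with
  | empty => simp
  | insert ν S hν ih =>
    rw [Finset.sum_insert hν] at hsum
    have h1 : ∑ μ ∈ S, (μ - ν) • x μ ∈ N := by
      have h := N.sub_mem (hN _ hsum) (N.smul_mem ν hsum)
      rw [map_add, map_sum, hx ν (Finset.mem_insert_self _ _), smul_add, add_sub_add_left_eq_sub,
        Finset.smul_sum, ← Finset.sum_sub_distrib] at h
      rwa [Finset.sum_congr rfl fun μ hμ => by
        rw [hx μ (Finset.mem_insert_of_mem hμ), ← sub_smul]] at h
    have h2 : ∀ μ ∈ S, x μ ∈ N := by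
      intro μ hμ
      have hne : μ - ν ≠ 0 := sub_ne_zero.mpr fun h => hν (h ▸ hμ)
      have h := ih (fun μ => (μ - ν) • x μ) (fun μ hμ => by
        rw [map_smul, hx μ (Finset.mem_insert_of_mem hμ), smul_comm]) h1 μ hμ
      simpa [smul_smul, inv_mul_cancel₀ hne] using N.smul_mem (μ - ν)⁻¹ h
    intro μ hμ
    rcases Finset.mem_insert.mp hμ with rfl | hμ
    · simpa using N.sub_mem hsum (N.sum_mem h2)
    · exact h2 μ hμ

/-- A subspace invariant under a diagonalizable operator is spanned by eigenvectors. -/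
theorem le_of_eigenvectors_le {V : Type*} [AddCommGroup V] [Module ℂ V]
    {f : Module.End ℂ V} (hf : ⨆ μ, f.eigenspace μ = ⊤) {N M : Submodule ℂ V}
    (hN : ∀ v ∈ N, f v ∈ N) (h : ∀ μ : ℂ, ∀ v ∈ N, f v = μ • v → v ∈ M) : N ≤ M := by
  classical
  intro v hv
  have hv' : v ∈ ⨆ μ, f.eigenspace μ := hf ▸ Submodule.mem_top
  obtain ⟨x, hx, rfl⟩ := (Submodule.mem_iSup_iff_exists_finsupp _ _).mp hv'
  have hx' (μ) : f (x μ) = μ • x μ := Module.End.mem_eigenspace_iff.mp (hx μ)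
  exact M.sum_mem fun μ hμ =>
    h μ _ (mem_of_sum_eigenvectors_mem hN _ x (fun μ _ => hx' μ) hv μ hμ) (hx' μ)

theorem AffineType.d_pos (X : AffineType) (i : X.Node) : 0 < X.d i := by
  cases X <;> simp only [AffineType.d] <;> (try split_ifs) <;> norm_num

/-! ### The operators of the generators -/

section Operators

variable {X : AffineType} {q κ k l : ℂ} {V : Type*} [AddCommGroup V] [Module ℂ V]
  [Module (U X q κ) V] [IsScalarTower ℂ (U X q κ) V]

theorem act_eq_of_rel {x y : Free X} (h : Rel X q κ x y) : act X q κ V x = act X q κ V y := by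
  simp only [act, AlgHom.comp_apply, RingQuot.mkAlgHom_rel ℂ h]

theorem exists_act_eq_smul (u : U X q κ) : ∃ x : Free X, ∀ v : V, u • v = act X q κ V x v := by
  obtain ⟨x, rfl⟩ := RingQuot.mkAlgHom_surjective ℂ (Rel X q κ) u
  exact ⟨x, fun _ => rfl⟩

theorem act_mem_of_gen_mem {N : Submodule ℂ V}
    (h : ∀ g, ∀ v ∈ N, act X q κ V (gen g) v ∈ N) (x : Free X) :
    ∀ v ∈ N, act X q κ V x v ∈ N := by
  induction x using FreeAlgebra.induction with
  | grade0 r =>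
    intro v hv
    rw [AlgHom.commutes]
    exact N.smul_mem r hv
  | grade1 g => exact h g
  | mul x y hx hy =>
    intro v hv
    rw [map_mul]
    exact hx _ (hy _ hv)
  | add x y hx hy =>
    intro v hv
    rw [map_add]
    exact N.add_mem (hx _ hv) (hy _ hv)

/-- A subspace stable under the generators, as a submodule. -/
def submoduleOfGen (N : Submodule ℂ V) (h : ∀ g, ∀ v ∈ N, act X q κ V (gen g) v ∈ N) :
    Submodule (U X q κ) V where
  carrier := N
  add_mem' := N.add_mem
  zero_mem' := N.zero_mem
  smul_mem' := fun u v hv => by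
    obtain ⟨x, hx⟩ := exists_act_eq_smul (V := V) u
    rw [hx]
    exact act_mem_of_gen_mem h x v hv

theorem aFree_zero (i : X.Node) : aFree i 0 = 0 := by simp [aFree]

theorem aOp_zero (i : X.Node) : aOp X q κ V i 0 = 0 := by simp [aOp, aFree_zero]

theorem act_qcPow (hV : InCategory X q κ k l V) (hq : q ≠ 0) (n : ℤ) :
    act X q κ V (qcPow n) = (q ^ (k / 2)) ^ n • (1 : Module.End ℂ V) := by
  have hc : q ^ (k / 2) ≠ 0 := by simp [Complex.cpow_eq_zero_iff, hq]
  have hinv : act X q κ V (gen .qcInv) = (q ^ (k / 2))⁻¹ • (1 : Module.End ℂ V) := by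
    have h := act_eq_of_rel (V := V) (Rel.qc_qcInv (X := X) (q := q) (κ := κ))
    rw [map_mul, map_one, hV.level_c, smul_mul_assoc, one_mul] at h
    rw [← h, smul_smul, inv_mul_cancel₀ hc, one_smul]
  cases n with
  | ofNat n => simp [qcPow, hV.level_c, smul_pow]
  | negSucc n => simp [qcPow, hinv, smul_pow]

/-- Because of this identity, passing from a^∨_{i,m} to a_{i,m} = [d_i] a^∨_{i,m} replaces [a_{ij}
m]_i by [b_{ij} m]. -/
theorem qint_mul_qint {d : ℕ} (hd : q ^ d - (q ^ d)⁻¹ ≠ 0) (n : ℤ) :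
    qint q d * qint (q ^ d) n = qint q (d * n) := by
  simp only [qint, zpow_neg, zpow_natCast, zpow_mul]
  generalize q ^ d - (q ^ d)⁻¹ = x at hd
  field_simp

theorem pow_sub_inv_ne_zero (hqr : ∀ n : ℤ, q ^ n = 1 → n = 0) (hq : q ≠ 0) {d : ℕ}
    (hd : 0 < d) : q ^ d - (q ^ d)⁻¹ ≠ 0 := by
  intro h
  have hqd : q ^ d ≠ 0 := pow_ne_zero d hq
  have h1 : q ^ (2 * d : ℤ) = 1 := by
    rw [two_mul, zpow_add₀ hq, zpow_natCast]
    nth_rewrite 1 [sub_eq_zero.mp h]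
    exact inv_mul_cancel₀ hqd
  have := hqr _ h1
  omega

/-- The structure constants of the Heisenberg relations, up to a factor depending on the level. -/
noncomputable def heisConst (X : AffineType) (q κ : ℂ) (i j : X.Node) (n : ℤ) : ℂ :=
  qint q (X.symm i j * n) / n * κ ^ (-n * X.kExp i j)

theorem aOp_mul_aOp (hV : InCategory X q κ k l V) (hq : q ≠ 0)
    (hqr : ∀ n : ℤ, q ^ n = 1 → n = 0) (i j : X.Node) {m n : ℤ} (hm : m ≠ 0) (hn : n ≠ 0) :
    aOp X q κ V i m * aOp X q κ V j n = aOp X q κ V j n * aOp X q κ V i m +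
      if m + n = 0 then (heisConst X q κ i j m *
        (((q ^ (k / 2)) ^ (2 * m) - (q ^ (k / 2)) ^ (-(2 * m))) / (q - q⁻¹))) •
          (1 : Module.End ℂ V) else 0 := by
  have hi := pow_sub_inv_ne_zero hqr hq (X.d_pos i)
  have hj := pow_sub_inv_ne_zero hqr hq (X.d_pos j)
  have h := act_eq_of_rel (V := V) (Rel.a_a (q := q) (κ := κ) i j m n hm hn)
  rw [map_sub, map_mul, map_mul, sub_eq_iff_eq_add'] at h
  rw [aOp, aOp, smul_mul_smul_comm, h, smul_mul_smul_comm, smul_add, mul_comm (qint q (X.d j))]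
  congr 1
  split_ifs
  · rw [map_smul, map_sub, act_qcPow hV hq, act_qcPow hV hq, ← sub_smul, smul_smul, smul_smul]
    congr 1
    -- The factor [d_j] turns the denominator q_j - q_j⁻¹ into q - q⁻¹, which does not depend on j.
    have h1 : qint q (X.d j) = (q ^ X.d j - (q ^ X.d j)⁻¹) / (q - q⁻¹) := by
      simp [qint]
    rw [heisConst, AffineType.symm, mul_assoc (X.d i : ℤ), ← qint_mul_qint hi, h1]
    generalize q ^ X.d j - (q ^ X.d j)⁻¹ = x at hj
    field_simp
  · rw [map_zero, smul_zero]

theorem aOp_mul_x (hV : InCategory X q κ k l V) (hq : q ≠ 0)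
    (hqr : ∀ n : ℤ, q ^ n = 1 → n = 0) (ε : ℤˣ) (i j : X.Node) {m : ℤ} (n : ℤ) (hm : m ≠ 0) :
    aOp X q κ V i m * act X q κ V (xFree ε j n) = act X q κ V (xFree ε j n) * aOp X q κ V i m +
      (((ε : ℤ) : ℂ) * heisConst X q κ i j m * (q ^ (k / 2)) ^ (-((ε : ℤ) * |m|))) •
        act X q κ V (xFree ε j (n + m)) := by
  have hi := pow_sub_inv_ne_zero hqr hq (X.d_pos i)
  have h := act_eq_of_rel (V := V) (Rel.a_x (q := q) (κ := κ) ε i j m n hm)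
  rw [map_sub, map_mul, map_mul, sub_eq_iff_eq_add', map_smul, map_mul, act_qcPow hV hq,
    smul_mul_assoc, one_mul, smul_smul] at h
  rw [aOp, smul_mul_assoc, h, smul_add, mul_smul_comm, smul_smul, heisConst, AffineType.symm,
    mul_assoc (X.d i : ℤ), ← qint_mul_qint hi]
  congr 2
  ring

theorem k_mul_aOp (i j : X.Node) (m : ℤ) :
    act X q κ V (gen (.k i)) * aOp X q κ V j m = aOp X q κ V j m * act X q κ V (gen (.k i)) := by
  rw [aOp, mul_smul_comm, smul_mul_assoc, ← map_mul, act_eq_of_rel (Rel.k_a i j m), map_mul]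

theorem kInv_mul_aOp (i j : X.Node) (m : ℤ) :
    act X q κ V (gen (.kInv i)) * aOp X q κ V j m =
      aOp X q κ V j m * act X q κ V (gen (.kInv i)) := by
  have h1 : act X q κ V (gen (.k i)) * act X q κ V (gen (.kInv i)) = 1 := by
    rw [← map_mul, act_eq_of_rel (Rel.k_kInv i), map_one]
  have h2 : act X q κ V (gen (.kInv i)) * act X q κ V (gen (.k i)) = 1 := by
    rw [← map_mul, act_eq_of_rel (Rel.kInv_k i), map_one]
  calc _ = act X q κ V (gen (.kInv i)) * (aOp X q κ V j m * act X q κ V (gen (.k i))) *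
        act X q κ V (gen (.kInv i)) := by rw [mul_assoc, mul_assoc, h1, mul_one]
    _ = _ := by rw [← k_mul_aOp, ← mul_assoc, h2, one_mul]

theorem qd_mul_aOp (i : X.Node) (m : ℤ) :
    act X q κ V (gen .qd) * aOp X q κ V i m =
      q ^ m • (aOp X q κ V i m * act X q κ V (gen .qd)) := by
  rw [aOp, mul_smul_comm, smul_mul_assoc, ← map_mul, act_eq_of_rel (Rel.qd_a i m), map_smul,
    map_mul, smul_comm]

theorem qd_mul_x (ε : ℤˣ) (i : X.Node) (n : ℤ) :
    act X q κ V (gen .qd) * act X q κ V (xFree ε i n) =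
      q ^ n • (act X q κ V (xFree ε i n) * act X q κ V (gen .qd)) := by
  rw [← map_mul, act_eq_of_rel (Rel.qd_x ε i n), map_smul, map_mul]

/-! ### Degrees -/

theorem mem_degreeSpace {ω : ℂ} {v : V} :
    v ∈ degreeSpace X q κ V ω ↔ act X q κ V (gen .qd) v = q ^ ω • v :=
  Module.End.mem_eigenspace_iff

variable (X q κ V) in
/-- The operators of degree `n`. -/
def shiftSpace (n : ℤ) : Submodule ℂ (Module.End ℂ V) where
  carrier := {T | ∀ ω, ∀ v ∈ degreeSpace X q κ V ω, T v ∈ degreeSpace X q κ V (ω + n)}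
  add_mem' := fun hS hT ω v hv => Submodule.add_mem _ (hS ω v hv) (hT ω v hv)
  zero_mem' := fun _ _ _ => Submodule.zero_mem _
  smul_mem' := fun c _ hT ω v hv => Submodule.smul_mem _ c (hT ω v hv)

theorem mem_shiftSpace_of_qd_mul (hq : q ≠ 0) {T : Module.End ℂ V} {n : ℤ}
    (h : act X q κ V (gen .qd) * T = q ^ n • (T * act X q κ V (gen .qd))) :
    T ∈ shiftSpace X q κ V n := by
  intro ω v hv
  rw [mem_degreeSpace] at hv ⊢
  have := LinearMap.congr_fun h v
  simp only [Module.End.mul_apply, LinearMap.smul_apply, hv, map_smul] at this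
  rw [this, smul_smul, Complex.cpow_add _ _ hq, Complex.cpow_intCast, mul_comm]

theorem one_mem_shiftSpace : (1 : Module.End ℂ V) ∈ shiftSpace X q κ V 0 := by
  intro ω v hv
  simpa using hv

theorem mul_mem_shiftSpace {S T : Module.End ℂ V} {m n : ℤ} (hS : S ∈ shiftSpace X q κ V m)
    (hT : T ∈ shiftSpace X q κ V n) : S * T ∈ shiftSpace X q κ V (m + n) := by
  intro ω v hv
  have := hS _ _ (hT _ _ hv)
  rwa [add_assoc, ← Int.cast_add, add_comm n m] at this

theorem aOp_mem_shiftSpace (hq : q ≠ 0) (i : X.Node) (m : ℤ) :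
    aOp X q κ V i m ∈ shiftSpace X q κ V m :=
  mem_shiftSpace_of_qd_mul hq (qd_mul_aOp i m)

theorem x_mem_shiftSpace (hq : q ≠ 0) (ε : ℤˣ) (i : X.Node) (n : ℤ) :
    act X q κ V (xFree ε i n) ∈ shiftSpace X q κ V n :=
  mem_shiftSpace_of_qd_mul hq (qd_mul_x ε i n)

theorem ePlus_mem_shiftSpace (hq : q ≠ 0) (ε : ℤˣ) (i : X.Node) (s : ℕ) :
    ePlus X q κ k V ε i s ∈ shiftSpace X q κ V s :=
  expCoeff_mem (fun n : ℕ => shiftSpace X q κ V n) (by exact_mod_cast one_mem_shiftSpace)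
    (fun m n _ _ hx hy => by
      rw [Nat.cast_add]
      exact mul_mem_shiftSpace hx hy)
    (fun m _ => Submodule.smul_mem _ _ (aOp_mem_shiftSpace hq i m)) s

theorem exists_forall_degreeSpace_eq_bot (hV : InCategory X q κ k l V) (ω : ℂ) :
    ∃ n₀ : ℕ, ∀ j : ℤ, n₀ < j → degreeSpace X q κ V (ω + j) = ⊥ := by
  obtain ⟨n₀, h⟩ := hV.truncated ω
  refine ⟨n₀, fun j hj => ?_⟩
  lift j to ℕ using by omega
  exact_mod_cast h j (by exact_mod_cast hj)

theorem iSup_eigenspace_qd (hV : InCategory X q κ k l V) :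
    ⨆ μ : ℂ, (act X q κ V (gen .qd)).eigenspace μ = ⊤ := by
  rw [eq_top_iff, ← hV.graded]
  exact iSup_le fun ω =>
    le_iSup (fun μ : ℂ => (act X q κ V (gen .qd)).eigenspace μ) (q ^ ω)

theorem act_qdInv_qd (v : V) :
    act X q κ V (gen .qdInv) (act X q κ V (gen .qd) v) = v := by
  rw [← Module.End.mul_apply, ← map_mul, act_eq_of_rel Rel.qdInv_qd, map_one,
    Module.End.one_apply]

/-- A subspace stable under `q^d` is spanned by homogeneous vectors. -/
theorem le_of_degree_le (hV : InCategory X q κ k l V) (hq : q ≠ 0) (hq1 : q ≠ 1)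
    {N M : Submodule ℂ V}
    (hN : ∀ v ∈ N, act X q κ V (gen .qd) v ∈ N)
    (h : ∀ ω, ∀ v ∈ N, v ∈ degreeSpace X q κ V ω → v ∈ M) : N ≤ M := by
  refine le_of_eigenvectors_le (iSup_eigenspace_qd hV) hN fun μ v hv hμ => ?_
  -- The eigenvalue 0 cannot occur on a nonzero vector since q^d is invertible; any other eigenvalue
  -- is q^ω with ω = log μ / log q.
  rcases eq_or_ne μ 0 with rfl | hμ0
  · have h0 := act_qdInv_qd (X := X) (q := q) (κ := κ) v
    rw [hμ, zero_smul, map_zero] at h0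
    rw [← h0]; exact M.zero_mem
  · refine h (Complex.log μ / Complex.log q) v hv (mem_degreeSpace.mpr ?_)
    have hlog : Complex.log q ≠ 0 := fun h => hq1 (by rw [← Complex.exp_log hq, h, Complex.exp_zero])
    rw [hμ, Complex.cpow_def_of_ne_zero hq, mul_div_cancel₀ _ hlog, Complex.exp_log hμ0]

end Operators

/-! ### Finitely supported sums -/

/-- Here `g` is `f` moved along `e` and extended by zero. The lemma makes a family cancel against
its own shift. -/
theorem finsum_eq_and_finite_of_injective {α M : Type*} [AddCommMonoid M] {e : α → α}
    (he : Function.Injective e) {f g : α → M} (hf : {p | f p ≠ 0}.Finite)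
    (hg : ∀ p, g (e p) = f p) (hg' : ∀ p ∉ Set.range e, g p = 0) :
    {p | g p ≠ 0}.Finite ∧ ∑ᶠ p, g p = ∑ᶠ p, f p := by
  constructor
  · refine (hf.image e).subset fun p hp => ?_
    by_cases h : p ∈ Set.range e
    · obtain ⟨p', rfl⟩ := h
      exact ⟨p', by simpa [hg] using hp, rfl⟩
    · exact absurd (hg' p h) hp
  · have h1 : ∑ᶠ p, g p = ∑ᶠ p ∈ Set.range e, g p := by
      refine finsum_congr fun p => ?_
      by_cases h : p ∈ Set.range e
      · simp [h]
      · simp [h, hg' p h]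
    rw [h1, finsum_mem_range he]
    exact finsum_congr hg

theorem finsum_mem_submodule {α W : Type*} [AddCommGroup W] [Module ℂ W] (N : Submodule ℂ W)
    {f : α → W} (h : ∀ p, f p ∈ N) : ∑ᶠ p, f p ∈ N :=
  finsum_induction (· ∈ N) N.zero_mem (fun _ _ hx hy => N.add_mem hx hy) h

/-! ### The operators `Z` -/

section ZOperators

variable {X : AffineType} {q κ k l : ℂ} {V : Type*} [AddCommGroup V] [Module ℂ V]
  [Module (U X q κ) V] [IsScalarTower ℂ (U X q κ) V]

/-- On V_ω the factor with index s raises the degree by s, so truncation bounds s. After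
X^±_{i,m+r-s} the total rise is m + r, so truncation bounds r too. -/
theorem zTerm_finite (hV : InCategory X q κ k l V) (hq : q ≠ 0) (ε : ℤˣ) (i : X.Node) (m : ℤ)
    (v : V) : {p : ℕ × ℕ | zTerm X q κ k V ε i m p v ≠ 0}.Finite := by
  have hv : v ∈ ⨆ ω : ℂ, degreeSpace X q κ V ω := hV.graded ▸ Submodule.mem_top
  induction hv using Submodule.iSup_induction' with
  | zero => simp
  | add v w _ _ hv hw =>
    refine (hv.union hw).subset fun p hp => ?_
    by_contra h
    simp only [Set.mem_union, Set.mem_ofPred_eq, not_or, not_not] at h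
    exact hp (by rw [map_add, h.1, h.2, add_zero])
  | mem ω v hv =>
    obtain ⟨n₀, h₀⟩ := exists_forall_degreeSpace_eq_bot hV ω
    refine ((Set.finite_Iic (n₀ + m.natAbs)).prod (Set.finite_Iic n₀)).subset fun p hp => ?_
    have h1 := ePlus_mem_shiftSpace (k := k) (V := V) (κ := κ) hq ε i p.2 ω v hv
    have h2 := x_mem_shiftSpace (V := V) (κ := κ) hq ε i (m + p.1 - p.2) _ _ h1
    rw [add_assoc, ← Int.cast_add] at h2
    simp only [Set.mem_prod, Set.mem_Iic]
    constructor
    · by_contra hlt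
      rw [h₀ _ (by omega), Submodule.mem_bot] at h2
      exact hp (by rw [zTerm, Module.End.mul_apply, Module.End.mul_apply, h2, map_zero])
    · by_contra hlt
      rw [h₀ _ (by omega), Submodule.mem_bot] at h1
      exact hp (by rw [zTerm, Module.End.mul_apply, h1, map_zero])

theorem zOp_apply (hV : InCategory X q κ k l V) (hq : q ≠ 0) (ε : ℤˣ) (i : X.Node) (m : ℤ)
    (v : V) : zOp X q κ k V ε i m v = ∑ᶠ p, zTerm X q κ k V ε i m p v := by
  rw [zOp, locSum, dif_pos (zTerm_finite hV hq ε i m)]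
  rfl

theorem aOp_commute_of_sign (hV : InCategory X q κ k l V) (hq : q ≠ 0)
    (hqr : ∀ n : ℤ, q ^ n = 1 → n = 0) (i j : X.Node) {m n : ℤ} (hmn : m + n ≠ 0) :
    aOp X q κ V i m * aOp X q κ V j n = aOp X q κ V j n * aOp X q κ V i m := by
  rcases eq_or_ne m 0 with rfl | hm
  · simp [aOp_zero]
  rcases eq_or_ne n 0 with rfl | hn
  · simp [aOp_zero]
  rw [aOp_mul_aOp hV hq hqr i j hm hn, if_neg hmn, add_zero]

theorem aOp_mul_ePlus_of_pos (hV : InCategory X q κ k l V) (hq : q ≠ 0)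
    (hqr : ∀ n : ℤ, q ^ n = 1 → n = 0) (ε : ℤˣ) (i j : X.Node) {n : ℤ} (hn : 0 < n) (s : ℕ) :
    aOp X q κ V i n * ePlus X q κ k V ε j s = ePlus X q κ k V ε j s * aOp X q κ V i n := by
  have h : ePlus X q κ k V ε j s ∈ Subalgebra.centralizer ℂ {aOp X q κ V i n} := by
    refine expCoeff_mem_subalgebra _ (fun m hm => Subalgebra.smul_mem _ ?_ _) s
    rw [Subalgebra.mem_centralizer_iff]
    rintro _ rfl
    exact aOp_commute_of_sign hV hq hqr i j (by omega)
  exact Subalgebra.mem_centralizer_iff ℂ |>.mp h _ rfl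

theorem aOp_mul_eMinus_of_neg (hV : InCategory X q κ k l V) (hq : q ≠ 0)
    (hqr : ∀ n : ℤ, q ^ n = 1 → n = 0) (ε : ℤˣ) (i j : X.Node) {n : ℤ} (hn : n < 0) (s : ℕ) :
    aOp X q κ V i n * eMinus X q κ k V ε j s = eMinus X q κ k V ε j s * aOp X q κ V i n := by
  have h : eMinus X q κ k V ε j s ∈ Subalgebra.centralizer ℂ {aOp X q κ V i n} := by
    refine expCoeff_mem_subalgebra _ (fun m hm => Subalgebra.smul_mem _ ?_ _) s
    rw [Subalgebra.mem_centralizer_iff]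
    rintro _ rfl
    exact aOp_commute_of_sign hV hq hqr i j (by omega)
  exact Subalgebra.mem_centralizer_iff ℂ |>.mp h _ rfl

/-- The coefficient of the commutator of `a_{i,n}` and `X^±_j(z)`. -/
noncomputable def shiftConst (X : AffineType) (q κ k : ℂ) (ε : ℤˣ) (i j : X.Node) (n : ℤ) : ℂ :=
  ((ε : ℤ) : ℂ) * heisConst X q κ i j n * (q ^ (k / 2)) ^ (-((ε : ℤ) * |n|))

/-- The level factor q^{kn} - q^{-kn} could vanish only if (q^{2k})^n = 1. This is where the
condition on q^{2k} is used. -/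
theorem cpow_half_zpow_ne (hq : q ≠ 0) (hk : ∀ n : ℕ, 0 < n → (q ^ (2 * k)) ^ n ≠ 1) {n : ℕ}
    (hn : 0 < n) :
    (q ^ (k / 2)) ^ (2 * (n : ℤ)) - (q ^ (k / 2)) ^ (-(2 * (n : ℤ))) ≠ 0 := by
  have hc : q ^ (k / 2) ≠ 0 := by simp [Complex.cpow_eq_zero_iff, hq]
  intro h
  refine hk n hn ?_
  have h4 : q ^ (2 * k) = (q ^ (k / 2)) ^ (4 : ℤ) := by
    rw [← Complex.cpow_int_mul]; congr 1; push_cast; ring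
  rw [h4, ← zpow_natCast, ← zpow_mul, show (4 : ℤ) * n = 2 * n + 2 * n by ring, zpow_add₀ hc]
  nth_rewrite 1 [sub_eq_zero.mp h]
  rw [← zpow_add₀ hc, neg_add_cancel, zpow_zero]

/-- The coefficient in the exponent of Z is chosen so that the level factor cancels and the constant
of [a_{i,n}, X^±_j(z)] remains. -/
theorem zCoeff_mul_heisConst (hq : q ≠ 0) (hqr : ∀ n : ℤ, q ^ n = 1 → n = 0)
    (hk : ∀ n : ℕ, 0 < n → (q ^ (2 * k)) ^ n ≠ 1) (ε : ℤˣ) {n : ℕ} (hn : 0 < n) (x : ℂ) :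
    zCoeff q k ε n * (x * (((q ^ (k / 2)) ^ (2 * (n : ℤ)) - (q ^ (k / 2)) ^ (-(2 * (n : ℤ)))) /
      (q - q⁻¹))) = ((ε : ℤ) : ℂ) * x * (q ^ (k / 2)) ^ (-((ε : ℤ) * (n : ℤ))) := by
  have h0 := cpow_half_zpow_ne hq hk hn
  have h1 : q - q⁻¹ ≠ 0 := by simpa using pow_sub_inv_ne_zero hqr hq one_pos
  have e1 : q ^ (k * n) = (q ^ (k / 2)) ^ (2 * (n : ℤ)) := by
    rw [← Complex.cpow_int_mul]; congr 1; push_cast; ring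
  have e2 : q ^ (-(k * n)) = (q ^ (k / 2)) ^ (-(2 * (n : ℤ))) := by
    rw [← Complex.cpow_int_mul]; congr 1; push_cast; ring
  have e3 : q ^ (-((ε : ℤ) : ℂ) * k * n / 2) = (q ^ (k / 2)) ^ (-((ε : ℤ) * (n : ℤ))) := by
    rw [← Complex.cpow_int_mul]; congr 1; push_cast; ring
  rw [zCoeff, e1, e2, e3]
  generalize (q ^ (k / 2)) ^ (2 * (n : ℤ)) - (q ^ (k / 2)) ^ (-(2 * (n : ℤ))) = y at h0
  generalize q - q⁻¹ = z at h1
  field_simp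

/-- The shift carries the constant of [a_{i,n}, X^±_j(z)] with the opposite sign, which is what
makes the two contributions cancel in Z^±_j(z). -/
theorem aOp_mul_eMinus (hV : InCategory X q κ k l V) (hq : q ≠ 0)
    (hqr : ∀ n : ℤ, q ^ n = 1 → n = 0) (hk : ∀ n : ℕ, 0 < n → (q ^ (2 * k)) ^ n ≠ 1)
    (ε : ℤˣ) (i j : X.Node) {n : ℕ} (hn : 0 < n) (r : ℕ) :
    aOp X q κ V i n * eMinus X q κ k V ε j r = eMinus X q κ k V ε j r * aOp X q κ V i n +
      if n ≤ r then (-shiftConst X q κ k ε i j n) • eMinus X q κ k V ε j (r - n) else 0 := by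
  refine mul_expCoeff_of_commutator hn (fun m hm => ?_) r
  rw [mul_smul_comm, smul_mul_assoc, aOp_mul_aOp hV hq hqr i j (by omega) (by omega), smul_add]
  congr 1
  by_cases h : m = n
  · subst h
    rw [if_pos (by omega), if_pos rfl, smul_smul, neg_mul, zCoeff_mul_heisConst hq hqr hk ε hm,
      Algebra.algebraMap_eq_smul_one, shiftConst, Nat.abs_cast]
  · rw [if_neg (by omega), if_neg h, smul_zero]

theorem aOp_mul_ePlus (hV : InCategory X q κ k l V) (hq : q ≠ 0)
    (hqr : ∀ n : ℤ, q ^ n = 1 → n = 0) (hk : ∀ n : ℕ, 0 < n → (q ^ (2 * k)) ^ n ≠ 1)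
    (ε : ℤˣ) (i j : X.Node) {n : ℕ} (hn : 0 < n) (s : ℕ) :
    aOp X q κ V i (-n) * ePlus X q κ k V ε j s = ePlus X q κ k V ε j s * aOp X q κ V i (-n) +
      if n ≤ s then (-shiftConst X q κ k ε i j (-n)) • ePlus X q κ k V ε j (s - n) else 0 := by
  refine mul_expCoeff_of_commutator hn (fun m hm => ?_) s
  rw [mul_smul_comm, smul_mul_assoc, aOp_mul_aOp hV hq hqr i j (by omega) (by omega), smul_add]
  congr 1
  by_cases h : m = n
  · subst h
    -- The level factor is odd in the mode. The resulting sign makes up for the opposite signs of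
    -- the exponents of `eMinus` and `ePlus`.
    have e : (2 * -(m : ℤ)) = -(2 * (m : ℤ)) := by ring
    rw [if_pos (by omega), if_pos rfl, smul_smul, e, neg_neg, ← neg_sub, neg_div, mul_neg, mul_neg,
      zCoeff_mul_heisConst hq hqr hk ε hm,
      Algebra.algebraMap_eq_smul_one, shiftConst, abs_neg, Nat.abs_cast]
  · rw [if_neg (by omega), if_neg h, smul_zero]

/-- The unshifted term comes from X^±, the shifted one from the left exponential; a_{i,n} passes the
right exponential freely. Summed over p, the two terms cancel. For negative modes the exponentials
exchange their roles. -/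
theorem aOp_zTerm_of_pos (hV : InCategory X q κ k l V) (hq : q ≠ 0)
    (hqr : ∀ n : ℤ, q ^ n = 1 → n = 0) (hk : ∀ n : ℕ, 0 < n → (q ^ (2 * k)) ^ n ≠ 1)
    (ε : ℤˣ) (i j : X.Node) {n : ℕ} (hn : 0 < n) (m : ℤ) (p : ℕ × ℕ) :
    aOp X q κ V i n * zTerm X q κ k V ε j m p = zTerm X q κ k V ε j m p * aOp X q κ V i n +
      shiftConst X q κ k ε i j n • (zTerm X q κ k V ε j (m + n) p -
        if n ≤ p.1 then zTerm X q κ k V ε j (m + n) (p.1 - n, p.2) else 0) := by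
  have hx := aOp_mul_x (V := V) hV hq hqr ε i j (m + p.1 - p.2) (show (n : ℤ) ≠ 0 by omega)
  rw [← shiftConst, show m + p.1 - p.2 + n = m + n + p.1 - p.2 by ring] at hx
  rw [zTerm, mul_assoc, ← mul_assoc, aOp_mul_eMinus hV hq hqr hk ε i j hn, add_mul,
    mul_assoc _ (aOp X q κ V i n), ← mul_assoc (aOp X q κ V i n), hx, add_mul,
    mul_assoc _ (aOp X q κ V i n),
    aOp_mul_ePlus_of_pos hV hq hqr ε i j (by omega), zTerm, zTerm]
  split_ifs with h
  · rw [show m + (n : ℤ) + ((p.1 - n : ℕ) : ℤ) - p.2 = m + p.1 - p.2 by omega]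
    simp only [mul_add, smul_mul_assoc, mul_smul_comm, neg_smul, neg_mul, smul_sub,
      mul_assoc]
    abel
  · simp only [mul_add, smul_mul_assoc, mul_smul_comm, zero_mul, add_zero, sub_zero, mul_assoc]

theorem aOp_zTerm_of_neg (hV : InCategory X q κ k l V) (hq : q ≠ 0)
    (hqr : ∀ n : ℤ, q ^ n = 1 → n = 0) (hk : ∀ n : ℕ, 0 < n → (q ^ (2 * k)) ^ n ≠ 1)
    (ε : ℤˣ) (i j : X.Node) {n : ℕ} (hn : 0 < n) (m : ℤ) (p : ℕ × ℕ) :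
    aOp X q κ V i (-n) * zTerm X q κ k V ε j m p = zTerm X q κ k V ε j m p * aOp X q κ V i (-n) +
      shiftConst X q κ k ε i j (-n) • (zTerm X q κ k V ε j (m - n) p -
        if n ≤ p.2 then zTerm X q κ k V ε j (m - n) (p.1, p.2 - n) else 0) := by
  have hx := aOp_mul_x (V := V) hV hq hqr ε i j (m + p.1 - p.2) (show -(n : ℤ) ≠ 0 by omega)
  rw [← shiftConst, show m + p.1 - p.2 + -n = m - n + p.1 - p.2 by ring] at hx
  rw [zTerm, mul_assoc, ← mul_assoc, aOp_mul_eMinus_of_neg hV hq hqr ε i j (by omega),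
    mul_assoc _ (aOp X q κ V i (-n)), ← mul_assoc (aOp X q κ V i (-n)), hx, add_mul,
    mul_assoc _ (aOp X q κ V i (-n)),
    aOp_mul_ePlus hV hq hqr hk ε i j hn, zTerm, zTerm]
  split_ifs with h
  · rw [show m - (n : ℤ) + p.1 - ((p.2 - n : ℕ) : ℤ) = m + p.1 - p.2 by omega]
    simp only [mul_add, smul_mul_assoc, mul_smul_comm, neg_smul, mul_neg, smul_sub, mul_assoc]
    abel
  · simp only [mul_add, smul_mul_assoc, mul_smul_comm, add_zero, sub_zero, mul_assoc]

/-- The operators `Z^±_{j,m}` commute with the Heisenberg operators. -/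
theorem aOp_zOp (hV : InCategory X q κ k l V) (hq : q ≠ 0)
    (hqr : ∀ n : ℤ, q ^ n = 1 → n = 0) (hk : ∀ n : ℕ, 0 < n → (q ^ (2 * k)) ^ n ≠ 1)
    (ε : ℤˣ) (i j : X.Node) (n m : ℤ) (v : V) :
    aOp X q κ V i n (zOp X q κ k V ε j m v) = zOp X q κ k V ε j m (aOp X q κ V i n v) := by
  -- Common part of both signs of n: `T` is `f` shifted along the injection `e`, so the sum of f - T
  -- vanishes.
  have main {T : ℕ × ℕ → V} {c : ℂ} {f : ℕ × ℕ → V} {e : ℕ × ℕ → ℕ × ℕ}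
      (he : Function.Injective e) (hf : {p | f p ≠ 0}.Finite) (hT : ∀ p, T (e p) = f p)
      (hT' : ∀ p ∉ Set.range e, T p = 0)
      (h : ∀ p, aOp X q κ V i n (zTerm X q κ k V ε j m p v) =
        zTerm X q κ k V ε j m p (aOp X q κ V i n v) + c • (f p - T p)) :
      aOp X q κ V i n (zOp X q κ k V ε j m v) = zOp X q κ k V ε j m (aOp X q κ V i n v) := by
    obtain ⟨hTf, hTs⟩ := finsum_eq_and_finite_of_injective he hf hT hT'
    have hfin : {p | c • (f p - T p) ≠ 0}.Finite := by
      refine (hf.union hTf).subset fun p hp => ?_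
      by_contra hcon
      simp only [Set.mem_union, Set.mem_ofPred_eq, not_or, not_not] at hcon
      exact hp (by rw [hcon.1, hcon.2, sub_zero, smul_zero])
    have hz : ∑ᶠ p, c • (f p - T p) = 0 := by
      rcases eq_or_ne c 0 with rfl | hc
      · simp
      · rw [← smul_finsum, finsum_sub_distrib hf hTf, hTs, sub_self, smul_zero]
    have hsum : aOp X q κ V i n (∑ᶠ p, zTerm X q κ k V ε j m p v) =
        ∑ᶠ p, aOp X q κ V i n (zTerm X q κ k V ε j m p v) :=
      (aOp X q κ V i n).toAddMonoidHom.map_finsum (zTerm_finite hV hq ε j m v)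
    rw [zOp_apply hV hq, zOp_apply hV hq, hsum, finsum_congr h,
      finsum_add_distrib (zTerm_finite hV hq ε j m _) hfin, hz, add_zero]
  obtain ⟨n, rfl | rfl⟩ := n.eq_nat_or_neg
  · rcases Nat.eq_zero_or_pos n with rfl | hn
    · simp [aOp_zero]
    · refine main (e := fun p => (p.1 + n, p.2)) (f := fun p => zTerm X q κ k V ε j (m + n) p v)
        (T := fun p => if n ≤ p.1 then zTerm X q κ k V ε j (m + n) (p.1 - n, p.2) v else 0)
        (fun p p' h => ?_) (zTerm_finite hV hq ε j _ v) (fun p => ?_) (fun p hp => ?_)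
        (c := shiftConst X q κ k ε i j n) (fun p => ?_)
      · simpa [Prod.ext_iff] using h
      · simp
      · exact if_neg fun h => hp ⟨(p.1 - n, p.2), by simp [h]⟩
      · have := LinearMap.congr_fun (aOp_zTerm_of_pos (V := V) hV hq hqr hk ε i j hn m p) v
        split_ifs at this ⊢ <;> simpa using this
  · rcases Nat.eq_zero_or_pos n with rfl | hn
    · simp [aOp_zero]
    · refine main (e := fun p => (p.1, p.2 + n)) (f := fun p => zTerm X q κ k V ε j (m - n) p v)
        (T := fun p => if n ≤ p.2 then zTerm X q κ k V ε j (m - n) (p.1, p.2 - n) v else 0)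
        (fun p p' h => ?_) (zTerm_finite hV hq ε j _ v) (fun p => ?_) (fun p hp => ?_)
        (c := shiftConst X q κ k ε i j (-n)) (fun p => ?_)
      · simpa [Prod.ext_iff] using h
      · simp
      · exact if_neg fun h => hp ⟨(p.1, p.2 - n), by simp [h]⟩
      · have := LinearMap.congr_fun (aOp_zTerm_of_neg (V := V) hV hq hqr hk ε i j hn m p) v
        split_ifs at this ⊢ <;> simpa using this

theorem apply_mem_of_mem_adjoin {N : Submodule ℂ V} {s : Set (Module.End ℂ V)}
    (hs : ∀ T ∈ s, ∀ v ∈ N, T v ∈ N) {T : Module.End ℂ V} (hT : T ∈ Algebra.adjoin ℂ s) :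
    ∀ v ∈ N, T v ∈ N := by
  induction hT using Algebra.adjoin_induction with
  | mem T hT => exact hs T hT
  | algebraMap r => exact fun v hv => N.smul_mem r hv
  | add S T _ _ hS hT => exact fun v hv => N.add_mem (hS v hv) (hT v hv)
  | mul S T _ _ hS hT => exact fun v hv => hS _ (hT v hv)

theorem eMinus_mem {N : Submodule ℂ V} (hN : ∀ i m, ∀ v ∈ N, aOp X q κ V i m v ∈ N)
    (ε : ℤˣ) (i : X.Node) (r : ℕ) : ∀ v ∈ N, eMinus X q κ k V ε i r v ∈ N :=
  apply_mem_of_mem_adjoin (s := {T | ∃ i m, T = aOp X q κ V i m})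
    (by rintro _ ⟨i, m, rfl⟩; exact hN i m)
    (expCoeff_mem_subalgebra _ (fun m _ => Subalgebra.smul_mem _
      (Algebra.subset_adjoin (show _ ∈ {T | ∃ i m, T = aOp X q κ V i m} from
        ⟨i, -(m : ℤ), rfl⟩)) _) r)

theorem ePlus_mem {N : Submodule ℂ V} (hN : ∀ i m, ∀ v ∈ N, aOp X q κ V i m v ∈ N)
    (ε : ℤˣ) (i : X.Node) (r : ℕ) : ∀ v ∈ N, ePlus X q κ k V ε i r v ∈ N :=
  apply_mem_of_mem_adjoin (s := {T | ∃ i m, T = aOp X q κ V i m})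
    (by rintro _ ⟨i, m, rfl⟩; exact hN i m)
    (expCoeff_mem_subalgebra _ (fun m _ => Subalgebra.smul_mem _
      (Algebra.subset_adjoin (show _ ∈ {T | ∃ i m, T = aOp X q κ V i m} from
        ⟨i, (m : ℤ), rfl⟩)) _) r)

theorem zOp_mem_of_x_mem (hV : InCategory X q κ k l V) (hq : q ≠ 0) {N : Submodule ℂ V}
    (hN : ∀ i m, ∀ v ∈ N, aOp X q κ V i m v ∈ N) {ε : ℤˣ} {i : X.Node}
    (hx : ∀ n, ∀ v ∈ N, act X q κ V (xFree ε i n) v ∈ N) (m : ℤ) :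
    ∀ v ∈ N, zOp X q κ k V ε i m v ∈ N := by
  intro v hv
  rw [zOp_apply hV hq]
  exact finsum_mem_submodule N fun p => eMinus_mem hN _ _ _ _ (hx _ _ (ePlus_mem hN _ _ _ _ hv))

/-- A subspace stable under `q^d`, the Heisenberg operators and the `Z^±_{i,m}` is stable under
the `X^±_{i,n}`. -/
theorem x_mem_of_zOp_mem (hV : InCategory X q κ k l V) (hq : q ≠ 0) (hq1 : q ≠ 1)
    {N : Submodule ℂ V} (hd : ∀ v ∈ N, act X q κ V (gen .qd) v ∈ N)
    (hN : ∀ i m, ∀ v ∈ N, aOp X q κ V i m v ∈ N) {ε : ℤˣ} {i : X.Node}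
    (hz : ∀ m, ∀ v ∈ N, zOp X q κ k V ε i m v ∈ N) (n : ℤ) :
    ∀ v ∈ N, act X q κ V (xFree ε i n) v ∈ N := by
  refine le_of_degree_le (M := N.comap (act X q κ V (xFree ε i n))) hV hq hq1 hd
    fun ω v hv hvω => ?_
  obtain ⟨n₀, h₀⟩ := exists_forall_degreeSpace_eq_bot hV ω
  -- The term p = (0, 0) of Z_n v is X_n v. A term with p.2 > 0 applies X to a vector of higher
  -- degree, which is covered by the induction on `A`. A term with p.2 = 0 and p.1 > 0 applies
  -- X_{n+p.1} to v itself, which is covered by the induction on `B`. Both inductions start from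
  -- truncation: `A` bounds how far the degree of v lies below the cutoff, `B` the same for X_n v.
  have key (A : ℕ) : ∀ j : ℤ, n₀ - j < A → ∀ v ∈ N, v ∈ degreeSpace X q κ V (ω + j) →
      ∀ n, act X q κ V (xFree ε i n) v ∈ N := by
    induction A with
    | zero =>
      intro j hj v _ hvj n
      rw [h₀ j (by push_cast at hj; omega), Submodule.mem_bot] at hvj
      rw [hvj, map_zero]; exact N.zero_mem
    | succ A ihA =>
      intro j hj v hv hvj n
      suffices H : ∀ B : ℕ, ∀ n : ℤ, n₀ - j - n < B → act X q κ V (xFree ε i n) v ∈ N from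
        H (n₀ - j - n + 1).toNat n (by omega)
      intro B
      induction B with
      | zero =>
        intro n hn
        have h := x_mem_shiftSpace (V := V) (κ := κ) hq ε i n _ _ hvj
        rw [add_assoc, ← Int.cast_add, h₀ _ (by push_cast at hn; omega), Submodule.mem_bot] at h
        rw [h]; exact N.zero_mem
      | succ B ihB =>
        intro n hn
        have hfin := zTerm_finite hV hq ε i n v
        have h := hz n v hv
        -- The index (0, 0) is inserted because its term may vanish and so be missing from the
        -- support.
        rw [zOp_apply hV hq, finsum_eq_sum_of_support_subset (s := insert (0, 0) hfin.toFinset) _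
          (fun p hp => by simp only [Finset.coe_insert, Set.Finite.coe_toFinset]; exact Or.inr hp),
          ← Finset.add_sum_erase _ _ (Finset.mem_insert_self _ _)] at h
        have hrest : ∑ p ∈ (insert (0, 0) hfin.toFinset).erase (0, 0),
            zTerm X q κ k V ε i n p v ∈ N := by
          refine N.sum_mem fun p hp => eMinus_mem hN _ _ _ _ ?_
          have hp0 := Finset.ne_of_mem_erase hp
          rcases Nat.eq_zero_or_pos p.2 with h2 | h2
          · have h1 : p.1 ≠ 0 := fun h1 => hp0 (Prod.ext h1 h2)
            rw [h2]
            have := ihB (n + p.1 - (0 : ℕ)) (by push_cast at hn ⊢; omega)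
            simpa [ePlus] using this
          · refine ihA (j + p.2) (by push_cast at hj; omega) _ (ePlus_mem hN _ _ _ _ hv) ?_ _
            have := ePlus_mem_shiftSpace (k := k) (V := V) (κ := κ) hq ε i p.2 _ _ hvj
            rwa [add_assoc, ← Int.cast_natCast p.2, ← Int.cast_add] at this
        have h' := (N.add_mem_iff_left hrest).mp h
        simpa [zTerm, eMinus, ePlus] using h'
  exact key (n₀ + 1) 0 (by simp) v hv (by simpa using hvω) n

end ZOperators

/-! ### Nondegeneracy of the quantized affine Cartan matrices -/

section Chains

variable {Q : ℂ}

/-- A Chebyshev recursion with characteristic roots Q and Q⁻¹. The first equation is the reflection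
condition y_{-1} = y_1, which selects the symmetric solution. -/
theorem two_mul_eq_of_chain (hQ : Q ≠ 0) {y : ℕ → ℂ} {L : ℕ} (h0 : (Q + Q⁻¹) * y 0 = 2 * y 1)
    (hrec : ∀ j, j + 2 ≤ L → (Q + Q⁻¹) * y (j + 1) = y j + y (j + 2)) :
    ∀ j, j ≤ L → 2 * y j = y 0 * (Q ^ j + Q⁻¹ ^ j) := by
  have hi : Q * Q⁻¹ = 1 := mul_inv_cancel₀ hQ
  intro j
  induction j using Nat.strong_induction_on with
  | _ j ih =>
    intro hj
    match j with
    | 0 => ring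
    | 1 => linear_combination -h0
    | j + 2 =>
      have h1 := ih j (by omega) (by omega)
      have h2 := ih (j + 1) (by omega) (by omega)
      have h3 := hrec j hj
      linear_combination (Q + Q⁻¹) * h2 - h1 - 2 * h3 + y 0 * (Q⁻¹ ^ j + Q ^ j) * hi

theorem pow_ne_inv_pow (hQ : Q ≠ 0) (hQr : ∀ n : ℕ, 0 < n → Q ^ n ≠ 1) {m n : ℕ}
    (h : 0 < m + n) : Q ^ m - Q⁻¹ ^ n ≠ 0 := by
  intro h0
  refine hQr (m + n) h ?_
  rw [pow_add, sub_eq_zero.mp h0, ← mul_pow, inv_mul_cancel₀ hQ, one_pow]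

theorem chain_eq_zero (hQ : Q ≠ 0) {y : ℕ → ℂ} {L : ℕ} (h0 : (Q + Q⁻¹) * y 0 = 2 * y 1)
    (hrec : ∀ j, j + 2 ≤ L → (Q + Q⁻¹) * y (j + 1) = y j + y (j + 2)) (hy : y 0 = 0) :
    ∀ j, j ≤ L → y j = 0 := by
  intro j hj
  simpa [hy] using two_mul_eq_of_chain hQ h0 hrec j hj

/-- Reflection at the far end, y_{L+2} = y_L, turns the closed form into (Q - Q⁻¹)(Q^{L+1} -
Q^{-L-1}) y_0 = 0. -/
theorem chain_eq_zero_of_reflect (hQ : Q ≠ 0) (hQr : ∀ n : ℕ, 0 < n → Q ^ n ≠ 1) {y : ℕ → ℂ}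
    {L : ℕ} (h0 : (Q + Q⁻¹) * y 0 = 2 * y 1)
    (hrec : ∀ j, j + 2 ≤ L + 1 → (Q + Q⁻¹) * y (j + 1) = y j + y (j + 2))
    (hend : (Q + Q⁻¹) * y (L + 1) = 2 * y L) : ∀ j, j ≤ L + 1 → y j = 0 := by
  have hi : Q * Q⁻¹ = 1 := mul_inv_cancel₀ hQ
  refine chain_eq_zero hQ h0 hrec ?_
  have h1 := two_mul_eq_of_chain hQ h0 hrec L (by omega)
  have h2 := two_mul_eq_of_chain hQ h0 hrec (L + 1) le_rfl
  have h3 : (Q ^ 1 - Q⁻¹ ^ 1) * (Q ^ (L + 1) - Q⁻¹ ^ (L + 1)) * y 0 = 0 := by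
    linear_combination 2 * hend - (Q + Q⁻¹) * h2 + 2 * h1 -
      2 * y 0 * (Q ^ L + Q⁻¹ ^ L) * hi
  exact (mul_eq_zero.mp h3).resolve_left (mul_ne_zero
    (pow_ne_inv_pow hQ hQr (by omega)) (pow_ne_inv_pow hQ hQr (by omega)))

/-- Here the far end reflects about the half-integer L + 1/2, and the closed form gives (Q - 1)(Q^L
- Q^{-L-1}) y_0 = 0. -/
theorem chain_eq_zero_of_half_reflect (hQ : Q ≠ 0) (hQr : ∀ n : ℕ, 0 < n → Q ^ n ≠ 1)
    {y : ℕ → ℂ} {L : ℕ} (h0 : (Q + Q⁻¹) * y 0 = 2 * y 1)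
    (hrec : ∀ j, j + 2 ≤ L + 1 → (Q + Q⁻¹) * y (j + 1) = y j + y (j + 2))
    (hend : y (L + 1) = y L) : ∀ j, j ≤ L + 1 → y j = 0 := by
  have hi : Q * Q⁻¹ = 1 := mul_inv_cancel₀ hQ
  refine chain_eq_zero hQ h0 hrec ?_
  have h1 := two_mul_eq_of_chain hQ h0 hrec L (by omega)
  have h2 := two_mul_eq_of_chain hQ h0 hrec (L + 1) le_rfl
  have h3 : (Q ^ 1 - Q⁻¹ ^ 0) * (Q ^ L - Q⁻¹ ^ (L + 1)) * y 0 = 0 := by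
    linear_combination 2 * hend - h2 + h1 - y 0 * Q⁻¹ ^ L * hi
  exact (mul_eq_zero.mp h3).resolve_left (mul_ne_zero
    (pow_ne_inv_pow hQ hQr (by omega)) (pow_ne_inv_pow hQ hQr (by omega)))

/-- With x = Q + Q⁻¹, the polynomials x, x² - 1, x² - 2, x² - 4 and x⁴ - 3x² + 1 are, up to powers
of Q, products of cyclotomic polynomials in Q: they vanish only if Q⁴, Q⁶, Q⁸, Q² or Q¹⁰,
respectively, is 1. They are the factors met in eliminating along the exceptional diagrams. -/
theorem add_inv_ne_zero (hQ : Q ≠ 0) (hQr : ∀ n : ℕ, 0 < n → Q ^ n ≠ 1) : Q + Q⁻¹ ≠ 0 := by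
  intro h
  have hi : Q * Q⁻¹ = 1 := mul_inv_cancel₀ hQ
  exact hQr 4 (by norm_num) (by linear_combination (Q ^ 3 - Q) * h + (1 - Q ^ 2) * hi)

theorem add_inv_sq_sub_one_ne_zero (hQ : Q ≠ 0) (hQr : ∀ n : ℕ, 0 < n → Q ^ n ≠ 1) :
    (Q + Q⁻¹) ^ 2 - 1 ≠ 0 := by
  intro h
  refine hQr 6 (by norm_num) ?_
  field_simp at h
  linear_combination (Q ^ 2 - 1) * h

theorem add_inv_sq_sub_two_ne_zero (hQ : Q ≠ 0) (hQr : ∀ n : ℕ, 0 < n → Q ^ n ≠ 1) :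
    (Q + Q⁻¹) ^ 2 - 2 ≠ 0 := by
  intro h
  refine hQr 8 (by norm_num) ?_
  field_simp at h
  linear_combination (Q ^ 4 - 1) * h

theorem add_inv_sq_sub_four_ne_zero (hQ : Q ≠ 0) (hQr : ∀ n : ℕ, 0 < n → Q ^ n ≠ 1) :
    (Q + Q⁻¹) ^ 2 - 4 ≠ 0 := by
  intro h
  have h1 : (Q ^ 2 - 1) ^ 2 = 0 := by
    field_simp at h
    linear_combination h
  exact hQr 2 (by norm_num) (sub_eq_zero.mp (pow_eq_zero_iff (by norm_num) |>.mp h1))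

theorem add_inv_quartic_ne_zero (hQ : Q ≠ 0) (hQr : ∀ n : ℕ, 0 < n → Q ^ n ≠ 1) :
    (Q + Q⁻¹) ^ 4 - 3 * (Q + Q⁻¹) ^ 2 + 1 ≠ 0 := by
  intro h
  refine hQr 10 (by norm_num) ?_
  field_simp at h
  linear_combination (Q ^ 2 - 1) * h

end Chains

/-! ### Kernel equations as relations between neighbouring nodes -/

section Rows

variable {X : AffineType} {Q K : ℂ}

/-- A vector indexed by the nodes, extended by zero to all natural numbers. -/
def extendNode (v : X.Node → ℂ) (n : ℕ) : ℂ := if h : n < X.rank + 1 then v ⟨n, h⟩ else 0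

theorem eq_zero_of_extendNode {v : X.Node → ℂ} (h : ∀ n, n < X.rank + 1 → extendNode v n = 0) :
    v = 0 := by
  funext i
  have := h i.val i.isLt
  rwa [extendNode, dif_pos i.isLt] at this

/-- The equations for a vector in the kernel of a quantized affine Cartan matrix. -/
theorem row_of_kernel (δ : ℕ → ℕ) (hδ : ∀ i, X.d i = δ i.val)
    (hdvd : ∀ m n, δ m ∣ max (δ m) (δ n)) (hk : ∀ i j, X.kExp i j = 0) {v : X.Node → ℂ}
    (hv : ∀ i, ∑ j, (Q ^ X.symm i j - Q ^ (-X.symm i j)) * K ^ (-X.kExp i j) * v j = 0)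
    {n : ℕ} (hn : n < X.rank + 1) :
    (Q ^ (2 * δ n) - Q⁻¹ ^ (2 * δ n)) * extendNode v n =
      ∑ m ∈ (Finset.range (X.rank + 1)).filter (fun m => m ≠ n ∧ (X.edge n m ∨ X.edge m n)),
        (Q ^ max (δ n) (δ m) - Q⁻¹ ^ max (δ n) (δ m)) * extendNode v m := by
  have h := hv ⟨n, hn⟩
  have hterm (j : X.Node) : (Q ^ X.symm ⟨n, hn⟩ j - Q ^ (-X.symm ⟨n, hn⟩ j)) *
      K ^ (-X.kExp ⟨n, hn⟩ j) * v j =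
      (if n = j.val then (Q ^ (2 * δ n) - Q⁻¹ ^ (2 * δ n)) * extendNode v j.val else 0) -
      (if j.val ≠ n ∧ (X.edge n j.val ∨ X.edge j.val n) then
        (Q ^ max (δ n) (δ j.val) - Q⁻¹ ^ max (δ n) (δ j.val)) * extendNode v j.val else 0) := by
    have hvj : extendNode v j.val = v j := dif_pos j.isLt
    rw [hk, neg_zero, zpow_zero, mul_one, hvj, AffineType.symm, AffineType.cartan, hδ, hδ]
    by_cases h1 : n = j.val
    · have h1' : (⟨n, hn⟩ : X.Node) = j := Fin.ext h1
      rw [if_pos h1', if_pos h1, if_neg (fun h => h.1 h1.symm), sub_zero,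
        show ((δ n : ℕ) : ℤ) * 2 = ((2 * δ n : ℕ) : ℤ) by push_cast; ring, zpow_neg, zpow_natCast,
        inv_pow]
    · have h1' : (⟨n, hn⟩ : X.Node) ≠ j := fun h => h1 (congrArg Fin.val h)
      rw [if_neg h1', if_neg h1, zero_sub]
      -- For adjacent nodes b_{ij} = -max(d_i, d_j), the division in the Cartan integer being exact
      -- by `hdvd`.
      by_cases h2 : X.edge n j.val ∨ X.edge j.val n
      · rw [if_pos h2, if_pos ⟨Ne.symm h1, h2⟩, mul_neg, ← Nat.cast_mul,
          Nat.mul_div_cancel' (hdvd _ _), neg_neg, zpow_neg, zpow_natCast, inv_pow]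
        ring
      · rw [if_neg h2, if_neg (fun h => h2 h.2)]
        simp
  rw [Finset.sum_congr rfl fun j _ => hterm j, Finset.sum_sub_distrib, sub_eq_zero,
    Fin.sum_univ_eq_sum_range (fun m => if n = m then
      (Q ^ (2 * δ n) - Q⁻¹ ^ (2 * δ n)) * extendNode v m else 0),
    Fin.sum_univ_eq_sum_range (fun m => if m ≠ n ∧ (X.edge n m ∨ X.edge m n) then
      (Q ^ max (δ n) (δ m) - Q⁻¹ ^ max (δ n) (δ m)) * extendNode v m else 0),
    Finset.sum_ite_eq, if_pos (Finset.mem_range.mpr hn), ← Finset.sum_filter] at h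
  exact h

/-- The same equations in the simply laced case. -/
theorem row_of_kernel_simplyLaced (hQ : Q ≠ 0) (hQr : ∀ n : ℕ, 0 < n → Q ^ n ≠ 1)
    (hd : ∀ i, X.d i = 1) (hk : ∀ i j, X.kExp i j = 0)
    {v : X.Node → ℂ}
    (hv : ∀ i, ∑ j, (Q ^ X.symm i j - Q ^ (-X.symm i j)) * K ^ (-X.kExp i j) * v j = 0)
    {n : ℕ} (hn : n < X.rank + 1) :
    (Q + Q⁻¹) * extendNode v n =
      ∑ m ∈ (Finset.range (X.rank + 1)).filter (fun m => m ≠ n ∧ (X.edge n m ∨ X.edge m n)),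
        extendNode v m := by
  have h := row_of_kernel (fun _ => 1) hd (fun _ _ => one_dvd _) hk hv hn
  rw [max_self, ← Finset.mul_sum] at h
  refine mul_left_cancel₀ (pow_ne_inv_pow hQ hQr (show 0 < 1 + 1 by norm_num)) ?_
  rw [← h]
  ring

end Rows

/-! ### Trivial kernels: the classical types -/

section Types

variable {Q K : ℂ}

/-- The matrix `(Q^{b_{ij}} - Q^{-b_{ij}}) K^{-m_{ij}}` has trivial kernel. -/
def KernelTrivial (X : AffineType) (Q K : ℂ) : Prop :=
  ∀ v : X.Node → ℂ,
    (∀ i, ∑ j, (Q ^ X.symm i j - Q ^ (-X.symm i j)) * K ^ (-X.kExp i j) * v j = 0) → v = 0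

open Fin.CommRing in
-- Going once around the cycle multiplies by c^(N+1), which is not 1.
theorem eq_zero_of_cyclic {N : ℕ} {c : ℂ} (hc : c ^ (N + 1) ≠ 1) {y : Fin (N + 1) → ℂ}
    (h : ∀ i, y i = c * y (i + 1)) : y = 0 := by
  have key (i : Fin (N + 1)) (n : ℕ) : y i = c ^ n * y (i + (n : Fin (N + 1))) := by
    induction n with
    | zero => simp
    | succ n ih => rw [ih, h (i + n), pow_succ, mul_assoc, Nat.cast_succ, add_assoc]
  funext i
  have h1 := key i (N + 1)
  rw [Fin.natCast_self, add_zero] at h1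
  have h2 : (1 - c ^ (N + 1)) * y i = 0 := by linear_combination h1
  exact (mul_eq_zero.mp h2).resolve_left (sub_ne_zero.mpr hc.symm)

/-- With S the cyclic shift, the row equation KS² - (Q + Q⁻¹)S + K⁻¹ factors as K⁻¹(KS - Q⁻¹)(KS -
Q). Each factor is injective by `eq_zero_of_cyclic`, because (QK)^(N+1) and (Q⁻¹K)^(N+1) differ from
1. Only in this type does K enter. -/
theorem kernelTrivial_A (N : ℕ) (hN : 2 ≤ N) (hQ : Q ≠ 0) (hK : K ≠ 0)
    (hgen : ∀ m n : ℤ, Q ^ m * K ^ n = 1 → m = 0 ∧ n = 0) : KernelTrivial (.A N hN) Q K := by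
  intro v hv
  change Fin (N + 1) → ℂ at v
  have hQr : ∀ n : ℕ, 0 < n → Q ^ n ≠ 1 := fun n hn h => by
    have := (hgen n 0 (by simpa using h)).1
    omega
  have hi : Q * Q⁻¹ = 1 := mul_inv_cancel₀ hQ
  have hKi : K * K⁻¹ = 1 := mul_inv_cancel₀ hK
  have hsucc (i j : Fin (N + 1)) : j = i + 1 ↔
      j.val = i.val + 1 ∨ (i.val = N ∧ j.val = 0) := by
    rw [Fin.ext_iff, Fin.val_add, Fin.val_one', Nat.mod_eq_of_lt (show 1 < N + 1 by omega)]
    rcases eq_or_ne i.val N with h | h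
    · rw [h, Nat.mod_self]; omega
    · rw [Nat.mod_eq_of_lt (by omega)]; omega
  have hedge (i j : Fin (N + 1)) :
      ((AffineType.A N hN).edge i j ∨ (AffineType.A N hN).edge j i) ↔ j = i + 1 ∨ i = j + 1 := by
    rw [hsucc, hsucc]
    simp only [AffineType.edge]
    omega
  have hterm (i j : Fin (N + 1)) :
      (Q ^ (AffineType.A N hN).symm i j - Q ^ (-(AffineType.A N hN).symm i j)) *
        K ^ (-(AffineType.A N hN).kExp i j) * v j =
      (if i = j then (Q ^ 2 - Q⁻¹ ^ 2) * v j else 0) -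
        (if i + 1 = j then (Q - Q⁻¹) * K * v j else 0) -
        (if i = j + 1 then (Q - Q⁻¹) * K⁻¹ * v j else 0) := by
    have hk : (AffineType.A N hN).kExp i j =
      (if i = j + 1 then 1 else 0) - (if i + 1 = j then 1 else 0) := rfl
    have hs : (AffineType.A N hN).symm i j =
        1 * (if i = j then 2 else if j = i + 1 ∨ i = j + 1 then -1 else 0) := by
      simp only [← hedge]
      change 1 * (if i = j then 2 else if (AffineType.A N hN).edge i j ∨
        (AffineType.A N hN).edge j i then -((max 1 1 / 1 : ℕ) : ℤ) else 0) = _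
      norm_num
    have h1 := hsucc i j
    have h2 := hsucc j i
    rw [hk, hs]
    by_cases c0 : i = j
    · have hv0 := congrArg Fin.val c0
      rw [if_pos c0, if_pos c0, if_neg (show ¬ i = j + 1 by omega),
        if_neg (show ¬ i + 1 = j from fun h => by have := h1.mp h.symm; omega),
        if_neg (show ¬ i + 1 = j from fun h => by have := h1.mp h.symm; omega),
        if_neg (show ¬ i = j + 1 by omega)]
      simp [zpow_ofNat]
    · rw [if_neg c0, if_neg c0]
      by_cases c1 : j = i + 1
      · have c2 : ¬ i = j + 1 := by omega
        rw [if_pos (Or.inl c1), if_neg c2, if_pos c1.symm, if_pos c1.symm, if_neg c2]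
        simp
        ring
      · by_cases c2 : i = j + 1
        · rw [if_pos (Or.inr c2), if_pos c2, if_neg (Ne.symm c1), if_neg (Ne.symm c1), if_pos c2]
          simp
          ring
        · rw [if_neg (by tauto), if_neg c2, if_neg (Ne.symm c1), if_neg (Ne.symm c1), if_neg c2]
          simp
  have hs1 : Q ^ 1 - Q⁻¹ ^ 1 ≠ 0 := pow_ne_inv_pow hQ hQr (by norm_num)
  have hrow (t : Fin (N + 1)) :
      (Q + Q⁻¹) * v (t + 1) = K * v (t + 1 + 1) + K⁻¹ * v t := by
    have h := (Finset.sum_congr (s₁ := (Finset.univ : Finset (Fin (N + 1)))) rfl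
      fun j _ => (hterm (t + 1) j).symm).trans (hv (t + 1 : Fin (N + 1)))
    simp only [add_left_inj, Finset.sum_sub_distrib, Finset.sum_ite_eq, Finset.mem_univ,
      if_true] at h
    refine mul_left_cancel₀ hs1 ?_
    linear_combination h
  have hy := eq_zero_of_cyclic (N := N) (c := Q * K) (y := fun i => K * v (i + 1) - Q * v i)
    (fun h => by
      have := (hgen (N + 1 : ℕ) (N + 1 : ℕ) (by
        rw [zpow_natCast, zpow_natCast, ← mul_pow, h])).1
      omega)
    (fun i => by
      linear_combination (Q * K) * hrow i - (K * v (i + 1)) * hi + Q * v i * hKi)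
  refine eq_zero_of_cyclic (N := N) (c := Q⁻¹ * K) (fun h => ?_) (fun i => ?_)
  · have := (hgen (-(N + 1 : ℕ)) (N + 1 : ℕ) (by
      rw [zpow_neg, zpow_natCast, zpow_natCast, ← inv_pow, ← mul_pow, h])).2
    omega
  · have := congrFun hy i
    simp only [Pi.zero_apply] at this
    linear_combination (-Q⁻¹) * this - v i * hi

/-- Adding the coordinates of the fork nodes 0 and 1 folds the diagram to a chain with parameter Q²
that reflects at the fork. The short node N gives u_N = u_{N-1}, a half reflection. The rows of 0
and 1 then kill the two fork coordinates separately. -/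
theorem kernelTrivial_B (N : ℕ) (hN : 3 ≤ N) (hQ : Q ≠ 0) (hQr : ∀ n : ℕ, 0 < n → Q ^ n ≠ 1) :
    KernelTrivial (.B N hN) Q K := by
  intro v hv
  set u := extendNode v with hu
  have row {n : ℕ} (hn : n < N + 1) (S : Finset ℕ)
      (hS : ∀ m, m ∈ S ↔ (m < N + 1 ∧ m ≠ n ∧
        (((n = 0 ∧ m = 2) ∨ (1 ≤ n ∧ m = n + 1)) ∨ ((m = 0 ∧ n = 2) ∨ (1 ≤ m ∧ n = m + 1))))) :
      (Q ^ (2 * if n = N then 1 else 2) - Q⁻¹ ^ (2 * if n = N then 1 else 2)) * u n =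
        ∑ m ∈ S, (Q ^ 2 - Q⁻¹ ^ 2) * u m := by
    rw [row_of_kernel (X := .B N hN) (fun n => if n = N then 1 else 2) (fun _ => rfl)
      (fun m n => by split_ifs <;> decide) (fun _ _ => rfl) hv hn]
    refine Finset.sum_congr ?_ fun m hm => ?_
    · ext m
      rw [hS, Finset.mem_filter, Finset.mem_range]
      rfl
    · have := (hS m).mp hm
      rw [show max (if n = N then 1 else 2) (if m = N then 1 else 2) = 2 by
        split_ifs <;> omega]
  have hs : Q ^ 2 - Q⁻¹ ^ 2 ≠ 0 := pow_ne_inv_pow hQ hQr (by norm_num)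
  have row' {n : ℕ} (hn : n < N) (S : Finset ℕ)
      (hS : ∀ m, m ∈ S ↔ (m < N + 1 ∧ m ≠ n ∧
        (((n = 0 ∧ m = 2) ∨ (1 ≤ n ∧ m = n + 1)) ∨ ((m = 0 ∧ n = 2) ∨ (1 ≤ m ∧ n = m + 1))))) :
      (Q ^ 2 + (Q ^ 2)⁻¹) * u n = ∑ m ∈ S, u m := by
    have h := row (by omega) S hS
    rw [if_neg (by omega), ← Finset.mul_sum] at h
    refine mul_left_cancel₀ hs ?_
    rw [← h, ← inv_pow]
    ring
  have r0 := row' (n := 0) (by omega) {2} (by simp; omega)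
  have r1 := row' (n := 1) (by omega) {2} (by simp; omega)
  have r2 := row' (n := 2) (by omega) {0, 1, 3} (by simp; omega)
  have rN := row (n := N) (by omega) {N - 1} (by simp; omega)
  rw [if_pos rfl, Finset.sum_singleton, mul_one] at rN
  have rN' := mul_left_cancel₀ hs rN
  simp only [Finset.sum_singleton] at r0 r1
  rw [Finset.sum_insert (by simp), Finset.sum_pair (by simp)] at r2
  obtain ⟨L, rfl⟩ : ∃ L, N = L + 2 := ⟨N - 2, by omega⟩
  have hP : Q ^ 2 ≠ 0 := pow_ne_zero 2 hQ
  have hPr : ∀ n : ℕ, 0 < n → (Q ^ 2) ^ n ≠ 1 := fun n hn => by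
    rw [← pow_mul]; exact hQr _ (by omega)
  have hy := chain_eq_zero_of_half_reflect hP hPr (L := L)
    (y := fun j => if j = 0 then u 0 + u 1 else u (j + 1))
    (by simp only [if_true, one_ne_zero, if_false]; linear_combination r0 + r1)
    (fun j hj => by
      rw [if_neg (show j + 1 ≠ 0 by omega), if_neg (show j + 2 ≠ 0 by omega)]
      rcases Nat.eq_zero_or_pos j with rfl | hj0
      · rw [if_pos rfl]; linear_combination r2
      · rw [if_neg (by omega), row' (n := j + 1 + 1) (by omega) {j + 1, j + 3} (by simp; omega),
          Finset.sum_pair (by omega)])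
    (by rw [if_neg (by omega), if_neg (by omega)]; exact rN')
  have hu2 (n : ℕ) (h2 : 2 ≤ n) (hn : n ≤ L + 2) : u n = 0 := by
    have := hy (n - 1) (by omega)
    rwa [if_neg (by omega), Nat.sub_add_cancel (by omega)] at this
  have hX := add_inv_ne_zero hP hPr
  refine eq_zero_of_extendNode fun n hn => ?_
  change n < L + 2 + 1 at hn
  rw [← hu]
  match n with
  | 0 => exact (mul_eq_zero.mp (r0.trans (hu2 2 le_rfl (by omega)))).resolve_left hX
  | 1 => exact (mul_eq_zero.mp (r1.trans (hu2 2 le_rfl (by omega)))).resolve_left hX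
  | n + 2 => exact hu2 _ (by omega) (by omega)

/-- Folding both forks by adding their coordinates leaves a chain reflecting at both ends. -/
theorem kernelTrivial_D (N : ℕ) (hN : 4 ≤ N) (hQ : Q ≠ 0) (hQr : ∀ n : ℕ, 0 < n → Q ^ n ≠ 1) :
    KernelTrivial (.D N hN) Q K := by
  intro v hv
  set u := extendNode v with hu
  have row {n : ℕ} (hn : n < N + 1) (S : Finset ℕ)
      (hS : ∀ m, m ∈ S ↔ (m < N + 1 ∧ m ≠ n ∧
        (((n = 0 ∧ m = 2) ∨ (1 ≤ n ∧ m = n + 1 ∧ m + 1 ≤ N) ∨ (n + 2 = N ∧ m = N)) ∨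
          ((m = 0 ∧ n = 2) ∨ (1 ≤ m ∧ n = m + 1 ∧ n + 1 ≤ N) ∨ (m + 2 = N ∧ n = N))))) :
      (Q + Q⁻¹) * u n = ∑ m ∈ S, u m := by
    rw [row_of_kernel_simplyLaced (X := .D N hN) hQ hQr (fun _ => rfl) (fun _ _ => rfl) hv hn]
    congr 1
    ext m
    rw [hS, Finset.mem_filter, Finset.mem_range]
    rfl
  obtain ⟨L, rfl⟩ : ∃ L, N = L + 3 := ⟨N - 3, by omega⟩
  have r0 := row (n := 0) (by omega) {2} (by simp; omega)
  have r1 := row (n := 1) (by omega) {2} (by simp; omega)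
  have rN := row (n := L + 3) (by omega) {L + 1} (by simp; omega)
  have rN' := row (n := L + 2) (by omega) {L + 1} (by simp; omega)
  simp only [Finset.sum_singleton] at r0 r1 rN rN'
  have hy := chain_eq_zero_of_reflect hQ hQr (L := L)
    (y := fun j => if j = 0 then u 0 + u 1 else if j = L + 1 then u (L + 2) + u (L + 3)
      else u (j + 1))
    (by
      rw [if_pos rfl, if_neg (by omega), if_neg (by omega)]
      linear_combination r0 + r1)
    (fun j hj => by
      rw [if_neg (by omega), if_neg (by omega), if_neg (show j + 2 ≠ 0 by omega)]
      rcases Nat.eq_zero_or_pos j with rfl | hj0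
      · rw [if_pos rfl]
        split_ifs with hL
        · obtain rfl : L = 1 := by omega
          rw [row (n := 2) (by omega) {0, 1, 3, 4} (by simp; omega),
            Finset.sum_insert (by simp), Finset.sum_insert (by simp), Finset.sum_pair (by simp)]
          ring
        · rw [row (n := 2) (by omega) {0, 1, 3} (by simp; omega),
            Finset.sum_insert (by simp), Finset.sum_pair (by simp)]
          ring
      · rw [if_neg (by omega), if_neg (by omega)]
        split_ifs with hL
        · obtain rfl : L = j + 1 := by omega
          rw [row (n := j + 1 + 1) (by omega) {j + 1, j + 3, j + 4} (by simp; omega),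
            Finset.sum_insert (by simp), Finset.sum_pair (by omega)]
        · rw [row (n := j + 1 + 1) (by omega) {j + 1, j + 3} (by simp; omega),
            Finset.sum_pair (by omega)])
    (by
      rw [if_neg (by omega), if_pos rfl, if_neg (by omega), if_neg (by omega)]
      linear_combination rN + rN')
  have hu2 (n : ℕ) (h2 : 2 ≤ n) (hn : n ≤ L + 1) : u n = 0 := by
    have := hy (n - 1) (by omega)
    rwa [if_neg (by omega), if_neg (by omega), Nat.sub_add_cancel (by omega)] at this
  have hX := add_inv_ne_zero hQ hQr
  refine eq_zero_of_extendNode fun n hn => ?_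
  change n < L + 3 + 1 at hn
  rw [← hu]
  rcases show n = 0 ∨ n = 1 ∨ (2 ≤ n ∧ n ≤ L + 1) ∨ n = L + 2 ∨ n = L + 3 by omega with
    rfl | rfl | ⟨h2, hn⟩ | rfl | rfl
  · exact (mul_eq_zero.mp (r0.trans (hu2 2 le_rfl (by omega)))).resolve_left hX
  · exact (mul_eq_zero.mp (r1.trans (hu2 2 le_rfl (by omega)))).resolve_left hX
  · exact hu2 n h2 hn
  · exact (mul_eq_zero.mp (rN'.trans (hu2 (L + 1) (by omega) le_rfl))).resolve_left hX
  · exact (mul_eq_zero.mp (rN.trans (hu2 (L + 1) (by omega) le_rfl))).resolve_left hX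

/-- At a long end the row reads (x² - 2) u_0 = u_1 with x = Q + Q⁻¹. This is two steps of the chain
recursion from 2u_0 through x u_0, so one auxiliary node at each end produces a reflecting chain. -/
theorem kernelTrivial_C (N : ℕ) (hN : 2 ≤ N) (hQ : Q ≠ 0) (hQr : ∀ n : ℕ, 0 < n → Q ^ n ≠ 1) :
    KernelTrivial (.C N hN) Q K := by
  intro v hv
  set u := extendNode v with hu
  have row {n : ℕ} (hn : n < N + 1) (S : Finset ℕ)
      (hS : ∀ m, m ∈ S ↔ (m < N + 1 ∧ m ≠ n ∧ (m = n + 1 ∨ n = m + 1))) :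
      (Q ^ (2 * if n = 0 ∨ n = N then 2 else 1) - Q⁻¹ ^ (2 * if n = 0 ∨ n = N then 2 else 1)) *
          u n = ∑ m ∈ S, (Q ^ max (if n = 0 ∨ n = N then 2 else 1) (if m = 0 ∨ m = N then 2 else 1)
            - Q⁻¹ ^ max (if n = 0 ∨ n = N then 2 else 1) (if m = 0 ∨ m = N then 2 else 1)) *
              u m := by
    rw [row_of_kernel (X := .C N hN) (fun n => if n = 0 ∨ n = N then 2 else 1) (fun _ => rfl)
      (fun m n => by split_ifs <;> decide) (fun _ _ => rfl) hv hn]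
    refine Finset.sum_congr ?_ fun m hm => rfl
    ext m
    rw [hS, Finset.mem_filter, Finset.mem_range]
    rfl
  have hi : Q * Q⁻¹ = 1 := mul_inv_cancel₀ hQ
  have hs1 : Q ^ 1 - Q⁻¹ ^ 1 ≠ 0 := pow_ne_inv_pow hQ hQr (by norm_num)
  have hs : Q ^ 2 - Q⁻¹ ^ 2 ≠ 0 := pow_ne_inv_pow hQ hQr (by norm_num)
  have r0 : ((Q + Q⁻¹) ^ 2 - 2) * u 0 = u 1 := by
    have h := row (n := 0) (by omega) {1} (by simp; omega)
    rw [Finset.sum_singleton, if_pos (by omega), max_eq_left (by split_ifs <;> omega)] at h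
    refine mul_left_cancel₀ hs ?_
    linear_combination h + 2 * (Q ^ 2 - Q⁻¹ ^ 2) * u 0 * hi
  have rN : ((Q + Q⁻¹) ^ 2 - 2) * u N = u (N - 1) := by
    have h := row (n := N) (by omega) {N - 1} (by simp; omega)
    rw [Finset.sum_singleton, if_pos (by omega), max_eq_left (by split_ifs <;> omega)] at h
    refine mul_left_cancel₀ hs ?_
    linear_combination h + 2 * (Q ^ 2 - Q⁻¹ ^ 2) * u N * hi
  have r {n : ℕ} (h0 : 0 < n) (hn : n < N) : (Q + Q⁻¹) * u n =
      (if n = 1 then (Q + Q⁻¹) * u (n - 1) else u (n - 1)) +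
      (if n + 1 = N then (Q + Q⁻¹) * u (n + 1) else u (n + 1)) := by
    have h := row (n := n) (by omega) {n - 1, n + 1} (by simp; omega)
    rw [Finset.sum_pair (by omega), if_neg (by omega)] at h
    have e1 : (Q ^ max 1 (if n - 1 = 0 ∨ n - 1 = N then 2 else 1) -
        Q⁻¹ ^ max 1 (if n - 1 = 0 ∨ n - 1 = N then 2 else 1)) * u (n - 1) =
        (Q ^ 1 - Q⁻¹ ^ 1) * (if n = 1 then (Q + Q⁻¹) * u (n - 1) else u (n - 1)) := by
      by_cases h1 : n = 1
      · rw [if_pos (by omega), if_pos h1, max_eq_right (by norm_num)]; ring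
      · rw [if_neg (by omega), if_neg h1, max_self]
    have e2 : (Q ^ max 1 (if n + 1 = 0 ∨ n + 1 = N then 2 else 1) -
        Q⁻¹ ^ max 1 (if n + 1 = 0 ∨ n + 1 = N then 2 else 1)) * u (n + 1) =
        (Q ^ 1 - Q⁻¹ ^ 1) * (if n + 1 = N then (Q + Q⁻¹) * u (n + 1) else u (n + 1)) := by
      by_cases h1 : n + 1 = N
      · rw [if_pos (by omega), if_pos h1, max_eq_right (by norm_num)]; ring
      · rw [if_neg (by omega), if_neg h1, max_self]
    rw [e1, e2, ← mul_add] at h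
    refine mul_left_cancel₀ hs1 ?_
    rw [← h]
    ring
  obtain ⟨L, rfl⟩ : ∃ L, N = L + 1 := ⟨N - 1, by omega⟩
  rw [Nat.add_sub_cancel] at rN
  set y : ℕ → ℂ := fun j => if j = 0 then 2 * u 0 else if j = 1 then (Q + Q⁻¹) * u 0 else
    if j = L + 2 then (Q + Q⁻¹) * u (L + 1) else if j = L + 3 then 2 * u (L + 1) else u (j - 1)
    with hydef
  have y0 : y 0 = 2 * u 0 := rfl
  have y1 : y 1 = (Q + Q⁻¹) * u 0 := rfl
  have yL2 : y (L + 2) = (Q + Q⁻¹) * u (L + 1) := by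
    rw [hydef]; dsimp only; rw [if_neg (by omega), if_neg (by omega), if_pos rfl]
  have yL3 : y (L + 3) = 2 * u (L + 1) := by
    rw [hydef]; dsimp only
    rw [if_neg (by omega), if_neg (by omega), if_neg (by omega), if_pos rfl]
  have ymid (j : ℕ) (h1 : 1 ≤ j) (h2 : j ≤ L) : y (j + 1) = u j := by
    rw [hydef]; dsimp only
    rw [if_neg (by omega), if_neg (by omega), if_neg (by omega), if_neg (by omega),
      Nat.add_sub_cancel]
  have hy := chain_eq_zero_of_reflect hQ hQr (L := L + 2) (y := y)
    (by rw [y0, y1]; ring)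
    (fun j hj => by
      rcases show j = 0 ∨ (1 ≤ j ∧ j ≤ L) ∨ j = L + 1 by omega with rfl | ⟨h1, h2⟩ | rfl
      · rw [zero_add, zero_add, y0, y1, ymid 1 (by omega) (by omega)]
        linear_combination r0
      · rw [ymid j h1 h2, r h1 (by omega)]
        congr 1
        · split_ifs with h
          · rw [h]; rfl
          · obtain ⟨j, rfl⟩ : ∃ i, j = i + 1 := ⟨j - 1, by omega⟩
            rw [ymid j (by omega) (by omega), Nat.add_sub_cancel]
        · split_ifs with h
          · obtain rfl : j = L := by omega
            exact yL2.symm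
          · exact (ymid (j + 1) (by omega) (by omega)).symm
      · rw [yL2, yL3, ymid L (by omega) le_rfl]
        linear_combination rN)
    (by rw [yL2, yL3]; ring)
  refine eq_zero_of_extendNode fun n hn => ?_
  change n < L + 1 + 1 at hn
  rw [← hu]
  rcases show n = 0 ∨ (1 ≤ n ∧ n ≤ L) ∨ n = L + 1 by omega with rfl | ⟨h1, h2⟩ | rfl
  · simpa [y0] using hy 0 (by omega)
  · rw [← ymid n h1 h2]; exact hy _ (by omega)
  · have := hy (L + 3) le_rfl
    simpa [yL3] using this

end Types

/-! ### Trivial kernels: the exceptional types -/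

section ExceptionalTypes

variable {Q K : ℂ}

/-- Elimination along the three arms: dividing by x² - 1 identifies the coordinates at their ends,
and the row of the branch node 4 becomes x(x² - 4) u_0 = 0. -/
theorem kernelTrivial_E6 (hQ : Q ≠ 0) (hQr : ∀ n : ℕ, 0 < n → Q ^ n ≠ 1) :
    KernelTrivial .E6 Q K := by
  intro v hv
  have row {n : ℕ} (hn : n < 7) := row_of_kernel_simplyLaced (X := .E6) (n := n) hQ hQr
    (fun _ => rfl) (fun _ _ => rfl) hv hn
  have n0 := add_inv_ne_zero hQ hQr
  have n1 := add_inv_sq_sub_one_ne_zero hQ hQr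
  have n4 := add_inv_sq_sub_four_ne_zero hQ hQr
  suffices H : ∀ n, n < 7 → extendNode v n = 0 from eq_zero_of_extendNode H
  generalize extendNode v = u at row ⊢
  generalize Q + Q⁻¹ = x at *
  have r0 := row (n := 0) (by norm_num)
  have r1 := row (n := 1) (by norm_num)
  have r2 := row (n := 2) (by norm_num)
  have r3 := row (n := 3) (by norm_num)
  have r4 := row (n := 4) (by norm_num)
  have r5 := row (n := 5) (by norm_num)
  have r6 := row (n := 6) (by norm_num)
  simp [Finset.sum_filter, AffineType.rank, AffineType.edge, Finset.sum_range_succ]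
    at r0 r1 r2 r3 r4 r5 r6
  have e4 : u 4 = (x ^ 2 - 1) * u 0 := by linear_combination -x * r0 - r2
  have e1 : u 1 = u 0 := mul_left_cancel₀ n1 (by linear_combination x * r1 + r3 + e4)
  have e6 : u 6 = u 0 := mul_left_cancel₀ n1 (by linear_combination x * r6 + r5 + e4)
  have key : x * (x ^ 2 - 4) * u 0 = 0 := by
    linear_combination r4 - x * e4 - r0 - r1 - r6 + x * e1 + x * e6
  have h0 : u 0 = 0 := (mul_eq_zero.mp key).resolve_left (mul_ne_zero n0 n4)
  rw [h0] at e1 e6 e4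
  rw [e1] at r1
  rw [e6] at r6
  rw [h0] at r0
  have h2 : u 2 = 0 := by linear_combination -r0
  have h3 : u 3 = 0 := by linear_combination -r1
  have h4 : u 4 = 0 := by linear_combination e4
  have h5 : u 5 = 0 := by linear_combination -r6
  intro n hn
  interval_cases n <;> assumption

/-- The long arm from node 0 determines u_4. The other long arm is matched with it by dividing by
x(x² - 2), the short one by dividing by x, and the branch node gives (x² - 1)(x² - 4) u_0 = 0. -/
theorem kernelTrivial_E7 (hQ : Q ≠ 0) (hQr : ∀ n : ℕ, 0 < n → Q ^ n ≠ 1) :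
    KernelTrivial .E7 Q K := by
  intro v hv
  have row {n : ℕ} (hn : n < 8) := row_of_kernel_simplyLaced (X := .E7) (n := n) hQ hQr
    (fun _ => rfl) (fun _ _ => rfl) hv hn
  have n0 := add_inv_ne_zero hQ hQr
  have n1 := add_inv_sq_sub_one_ne_zero hQ hQr
  have n2 := add_inv_sq_sub_two_ne_zero hQ hQr
  have n4 := add_inv_sq_sub_four_ne_zero hQ hQr
  suffices H : ∀ n, n < 8 → extendNode v n = 0 from eq_zero_of_extendNode H
  generalize extendNode v = u at row ⊢
  generalize Q + Q⁻¹ = x at *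
  have r0 := row (n := 0) (by norm_num)
  have r1 := row (n := 1) (by norm_num)
  have r2 := row (n := 2) (by norm_num)
  have r3 := row (n := 3) (by norm_num)
  have r4 := row (n := 4) (by norm_num)
  have r5 := row (n := 5) (by norm_num)
  have r6 := row (n := 6) (by norm_num)
  have r7 := row (n := 7) (by norm_num)
  simp [Finset.sum_filter, AffineType.rank, AffineType.edge, Finset.sum_range_succ]
    at r0 r1 r2 r3 r4 r5 r6 r7
  have e1 : u 1 = x * u 0 := by linear_combination -r0
  have e3 : u 3 = (x ^ 2 - 1) * u 0 := by linear_combination -r1 + x * e1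
  have e4 : u 4 = x * (x ^ 2 - 2) * u 0 := by linear_combination -r3 + x * e3 - e1
  have e7 : u 7 = u 0 := mul_left_cancel₀ (mul_ne_zero n0 n2) (by
    linear_combination r5 + x * r6 + (x ^ 2 - 1) * r7 + e4)
  have e6 : u 6 = x * u 0 := by linear_combination -r7 + x * e7
  have e5 : u 5 = (x ^ 2 - 1) * u 0 := by linear_combination -r6 + x * e6 - e7
  have e2 : u 2 = (x ^ 2 - 2) * u 0 := mul_left_cancel₀ n0 (by linear_combination r2 + e4)
  have key : (x ^ 2 - 1) * (x ^ 2 - 4) * u 0 = 0 := by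
    linear_combination r4 - x * e4 + e2 + e3 + e5
  have h0 : u 0 = 0 := (mul_eq_zero.mp key).resolve_left (mul_ne_zero n1 n4)
  rw [h0] at e1 e2 e3 e4 e5 e6 e7
  rw [mul_zero] at e1 e2 e3 e4 e5 e6
  intro n hn
  interval_cases n <;> assumption

/-- All coordinates are expressed through u_0, starting along the long arm; the branch node gives
(x² - 4)(x⁴ - 3x² + 1) u_0 = 0. -/
theorem kernelTrivial_E8 (hQ : Q ≠ 0) (hQr : ∀ n : ℕ, 0 < n → Q ^ n ≠ 1) :
    KernelTrivial .E8 Q K := by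
  intro v hv
  have row {n : ℕ} (hn : n < 9) := row_of_kernel_simplyLaced (X := .E8) (n := n) hQ hQr
    (fun _ => rfl) (fun _ _ => rfl) hv hn
  have n0 := add_inv_ne_zero hQ hQr
  have n1 := add_inv_sq_sub_one_ne_zero hQ hQr
  have n4 := add_inv_sq_sub_four_ne_zero hQ hQr
  have n5 := add_inv_quartic_ne_zero hQ hQr
  suffices H : ∀ n, n < 9 → extendNode v n = 0 from eq_zero_of_extendNode H
  generalize extendNode v = u at row ⊢
  generalize Q + Q⁻¹ = x at *
  have r0 := row (n := 0) (by norm_num)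
  have r1 := row (n := 1) (by norm_num)
  have r2 := row (n := 2) (by norm_num)
  have r3 := row (n := 3) (by norm_num)
  have r4 := row (n := 4) (by norm_num)
  have r5 := row (n := 5) (by norm_num)
  have r6 := row (n := 6) (by norm_num)
  have r7 := row (n := 7) (by norm_num)
  have r8 := row (n := 8) (by norm_num)
  simp [Finset.sum_filter, AffineType.rank, AffineType.edge, Finset.sum_range_succ]
    at r0 r1 r2 r3 r4 r5 r6 r7 r8
  have e8 : u 8 = x * u 0 := by linear_combination -r0
  have e7 : u 7 = (x ^ 2 - 1) * u 0 := by linear_combination -r8 + x * e8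
  have e6 : u 6 = (x ^ 3 - 2 * x) * u 0 := by linear_combination -r7 + x * e7 - e8
  have e5 : u 5 = (x ^ 4 - 3 * x ^ 2 + 1) * u 0 := by linear_combination -r6 + x * e6 - e7
  have e4 : u 4 = x * (x ^ 2 - 1) * (x ^ 2 - 3) * u 0 := by
    linear_combination -r5 + x * e5 - e6
  have e1 : u 1 = x * (x ^ 2 - 3) * u 0 := mul_left_cancel₀ n1 (by
    linear_combination r3 + x * r1 + e4)
  have e3 : u 3 = x ^ 2 * (x ^ 2 - 3) * u 0 := by linear_combination -r1 + x * e1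
  have e2 : u 2 = (x ^ 2 - 1) * (x ^ 2 - 3) * u 0 := mul_left_cancel₀ n0 (by
    linear_combination r2 + e4)
  have key : (x ^ 2 - 4) * (x ^ 4 - 3 * x ^ 2 + 1) * u 0 = 0 := by
    linear_combination r4 - x * e4 + e2 + e3 + e5
  have h0 : u 0 = 0 := (mul_eq_zero.mp key).resolve_left (mul_ne_zero n4 n5)
  rw [h0, mul_zero] at e1 e2 e3 e4 e5 e6 e7 e8
  intro n hn
  interval_cases n <;> assumption

/-- The long nodes obey the recursion with Q² + Q⁻² = x² - 2, the short ones that with x. The last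
row gives (x² - 4)(x² - 1)(x⁴ - 3x² + 1) u_0 = 0. -/
theorem kernelTrivial_F4 (hQ : Q ≠ 0) (hQr : ∀ n : ℕ, 0 < n → Q ^ n ≠ 1) :
    KernelTrivial .F4 Q K := by
  intro v hv
  have row {n : ℕ} (hn : n < 5) := row_of_kernel (X := .F4) (n := n)
    (fun n => if n ≤ 2 then 2 else 1) (fun _ => rfl) (fun m n => by split_ifs <;> decide)
    (fun _ _ => rfl) hv hn
  have n0 := add_inv_ne_zero hQ hQr
  have n1 := add_inv_sq_sub_one_ne_zero hQ hQr
  have n4 := add_inv_sq_sub_four_ne_zero hQ hQr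
  have n5 := add_inv_quartic_ne_zero hQ hQr
  have hi : Q * Q⁻¹ = 1 := mul_inv_cancel₀ hQ
  have s1 := pow_ne_inv_pow hQ hQr (show 0 < 1 + 1 by norm_num)
  have s2 := pow_ne_inv_pow hQ hQr (show 0 < 2 + 2 by norm_num)
  suffices H : ∀ n, n < 5 → extendNode v n = 0 from eq_zero_of_extendNode H
  generalize extendNode v = u at row ⊢
  have r0 := row (n := 0) (by norm_num)
  have r1 := row (n := 1) (by norm_num)
  have r2 := row (n := 2) (by norm_num)
  have r3 := row (n := 3) (by norm_num)
  have r4 := row (n := 4) (by norm_num)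
  simp [Finset.sum_filter, AffineType.rank, AffineType.edge, Finset.sum_range_succ,
    -mul_eq_mul_left_iff, -inv_pow] at r0 r1 r2 r3 r4
  have e1 : u 1 = ((Q + Q⁻¹) ^ 2 - 2) * u 0 := mul_left_cancel₀ s2 (by
    linear_combination -r0 - 2 * (Q ^ 2 - Q⁻¹ ^ 2) * u 0 * hi)
  have e2 : u 2 = ((Q + Q⁻¹) ^ 2 - 2) * u 1 - u 0 := mul_left_cancel₀ s2 (by
    linear_combination -r1 - 2 * (Q ^ 2 - Q⁻¹ ^ 2) * u 1 * hi)
  have e3 : u 3 = ((Q + Q⁻¹) ^ 2 - 2) * u 2 - u 1 := mul_left_cancel₀ s2 (by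
    linear_combination -r2 - 2 * (Q ^ 2 - Q⁻¹ ^ 2) * u 2 * hi)
  have e4 : u 4 = (Q + Q⁻¹) * u 3 - (Q + Q⁻¹) * u 2 := mul_left_cancel₀ s1 (by
    linear_combination -r3)
  have e5 : (Q + Q⁻¹) * u 4 = u 3 := mul_left_cancel₀ s1 (by linear_combination r4)
  generalize Q + Q⁻¹ = x at *
  have key : (x ^ 2 - 4) * ((x ^ 2 - 1) * (x ^ 4 - 3 * x ^ 2 + 1)) * u 0 = 0 := by
    rw [e4, e3, e2, e1] at e5
    linear_combination e5
  have h0 : u 0 = 0 :=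
    (mul_eq_zero.mp key).resolve_left (mul_ne_zero n4 (mul_ne_zero n1 n5))
  have h1 : u 1 = 0 := by rw [e1, h0, mul_zero]
  have h2 : u 2 = 0 := by rw [e2, h1, h0, mul_zero, sub_zero]
  have h3 : u 3 = 0 := by rw [e3, h2, h1, mul_zero, sub_zero]
  have h4 : u 4 = 0 := by rw [e4, h3, h2, mul_zero, sub_zero]
  intro n hn
  interval_cases n <;> assumption

/-- The long nodes obey the recursion with Q³ + Q⁻³ = x³ - 3x, and the short node closes it to x(x²
- 4)(x⁴ - 3x² + 1) u_0 = 0. -/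
theorem kernelTrivial_G2 (hQ : Q ≠ 0) (hQr : ∀ n : ℕ, 0 < n → Q ^ n ≠ 1) :
    KernelTrivial .G2 Q K := by
  intro v hv
  have row {n : ℕ} (hn : n < 3) := row_of_kernel (X := .G2) (n := n)
    (fun n => if n ≤ 1 then 3 else 1) (fun _ => rfl) (fun m n => by split_ifs <;> decide)
    (fun _ _ => rfl) hv hn
  have n0 := add_inv_ne_zero hQ hQr
  have n4 := add_inv_sq_sub_four_ne_zero hQ hQr
  have n5 := add_inv_quartic_ne_zero hQ hQr
  have hi : Q * Q⁻¹ = 1 := mul_inv_cancel₀ hQ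
  have s1 := pow_ne_inv_pow hQ hQr (show 0 < 1 + 1 by norm_num)
  have s3 := pow_ne_inv_pow hQ hQr (show 0 < 3 + 3 by norm_num)
  suffices H : ∀ n, n < 3 → extendNode v n = 0 from eq_zero_of_extendNode H
  generalize extendNode v = u at row ⊢
  have r0 := row (n := 0) (by norm_num)
  have r1 := row (n := 1) (by norm_num)
  have r2 := row (n := 2) (by norm_num)
  simp [Finset.sum_filter, AffineType.rank, AffineType.edge, Finset.sum_range_succ,
    -mul_eq_mul_left_iff, -inv_pow] at r0 r1 r2
  have hc : Q ^ 3 + Q⁻¹ ^ 3 = (Q + Q⁻¹) ^ 3 - 3 * (Q + Q⁻¹) := by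
    linear_combination -3 * (Q + Q⁻¹) * hi
  have e1 : u 1 = ((Q + Q⁻¹) ^ 3 - 3 * (Q + Q⁻¹)) * u 0 := mul_left_cancel₀ s3 (by
    rw [← hc]; linear_combination -r0)
  have e2 : u 2 = ((Q + Q⁻¹) ^ 3 - 3 * (Q + Q⁻¹)) * u 1 - u 0 := mul_left_cancel₀ s3 (by
    rw [← hc]; linear_combination -r1)
  have e3 : (Q + Q⁻¹) * u 2 = ((Q + Q⁻¹) ^ 2 - 1) * u 1 := mul_left_cancel₀ s1 (by
    linear_combination r2 - (Q - Q⁻¹) * u 1 * hi)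
  generalize Q + Q⁻¹ = x at *
  have key : x * ((x ^ 2 - 4) * (x ^ 4 - 3 * x ^ 2 + 1)) * u 0 = 0 := by
    rw [e2, e1] at e3
    linear_combination e3
  have h0 : u 0 = 0 :=
    (mul_eq_zero.mp key).resolve_left (mul_ne_zero n0 (mul_ne_zero n4 n5))
  have h1 : u 1 = 0 := by rw [e1, h0, mul_zero]
  have h2 : u 2 = 0 := by rw [e2, h1, h0, mul_zero, sub_zero]
  intro n hn
  interval_cases n <;> assumption

end ExceptionalTypes

/-- The quantized affine Cartan matrices are nondegenerate at generic parameters. -/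
theorem kernelTrivial_of_generic (X : AffineType) {Q K : ℂ} (hQ : Q ≠ 0) (hK : K ≠ 0)
    (hgen : ∀ m n : ℤ, Q ^ m * K ^ n = 1 → m = 0 ∧ n = 0) : KernelTrivial X Q K := by
  have hQr : ∀ n : ℕ, 0 < n → Q ^ n ≠ 1 := fun n hn h => by
    have := (hgen n 0 (by simpa using h)).1
    omega
  cases X with
  | A N hN => exact kernelTrivial_A N hN hQ hK hgen
  | B N hN => exact kernelTrivial_B N hN hQ hQr
  | C N hN => exact kernelTrivial_C N hN hQ hQr
  | D N hN => exact kernelTrivial_D N hN hQ hQr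
  | E6 => exact kernelTrivial_E6 hQ hQr
  | E7 => exact kernelTrivial_E7 hQ hQr
  | E8 => exact kernelTrivial_E8 hQ hQr
  | F4 => exact kernelTrivial_F4 hQ hQr
  | G2 => exact kernelTrivial_G2 hQ hQr

/-! ### Subspaces generated by creation operators -/

section CreationSpan

variable {V : Type*} [AddCommGroup V] [Module ℂ V] {ι : Type*}

/-- The smallest subspace containing `W` and stable under the operators `a p`. -/
def creationSpan (a : ι → Module.End ℂ V) (W : Submodule ℂ V) : Submodule ℂ V :=
  sInf {N | W ≤ N ∧ ∀ p, ∀ v ∈ N, a p v ∈ N}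

variable {a : ι → Module.End ℂ V} {W : Submodule ℂ V}

theorem creationSpan_le {N : Submodule ℂ V} (hW : W ≤ N) (hN : ∀ p, ∀ v ∈ N, a p v ∈ N) :
    creationSpan a W ≤ N :=
  sInf_le ⟨hW, hN⟩

theorem le_creationSpan : W ≤ creationSpan a W :=
  le_sInf fun _ hN => hN.1

theorem apply_mem_creationSpan (p : ι) : ∀ v ∈ creationSpan a W, a p v ∈ creationSpan a W := by
  intro v hv
  rw [creationSpan, Submodule.mem_sInf] at hv ⊢
  exact fun N hN => hN.2 p v (hv N hN)

/-- Induction over the span: the vectors of the span that `T` maps into the span form a subspace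
containing `W` and stable under the creation operators. -/
theorem mem_creationSpan_of_commutator {T : Module.End ℂ V}
    (hW : ∀ w ∈ W, T w ∈ creationSpan a W)
    (hT : ∀ p, ∀ v ∈ creationSpan a W, T v ∈ creationSpan a W → T (a p v) ∈ creationSpan a W) :
    ∀ v ∈ creationSpan a W, T v ∈ creationSpan a W := by
  have h : creationSpan a W ≤ creationSpan a W ⊓ (creationSpan a W).comap T :=
    creationSpan_le (le_inf le_creationSpan hW)
      fun p v hv => ⟨apply_mem_creationSpan p v hv.1, hT p v hv.1 hv.2⟩
  exact fun v hv => (h hv).2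

theorem creationSpan_le_sup_range : creationSpan a W ≤ W ⊔ ⨆ p, LinearMap.range (a p) :=
  creationSpan_le le_sup_left fun p v _ =>
    Submodule.mem_sup_right (Submodule.mem_iSup_of_mem p ⟨v, rfl⟩)

end CreationSpan

/-! ### Annihilation operators dual to the creation operators -/

/-- The matrix of the commutators of the `a_{i,n}` with the `a_{j,-n}` at level `k`. -/
noncomputable def heisMatrix (X : AffineType) (q κ k : ℂ) (n : ℕ) : Matrix X.Node X.Node ℂ :=
  Matrix.of fun i j => heisConst X q κ i j n *
    (((q ^ (k / 2)) ^ (2 * (n : ℤ)) - (q ^ (k / 2)) ^ (-(2 * (n : ℤ)))) / (q - q⁻¹))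

/-- Up to a nonzero scalar this is the quantized Cartan matrix with parameters q^n and κ^n, which
are again generic since n ≠ 0. -/
theorem isUnit_det_heisMatrix (X : AffineType) {q κ k : ℂ} (hq : q ≠ 0) (hκ : κ ≠ 0)
    (hgen : ∀ m n : ℤ, q ^ m * κ ^ n = 1 → m = 0 ∧ n = 0)
    (hk : ∀ n : ℕ, 0 < n → (q ^ (2 * k)) ^ n ≠ 1) {n : ℕ} (hn : 0 < n) :
    IsUnit (heisMatrix X q κ k n).det := by
  have hn' : (n : ℤ) ≠ 0 := by omega
  have hker := kernelTrivial_of_generic X (Q := q ^ (n : ℤ)) (K := κ ^ (n : ℤ))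
    (zpow_ne_zero _ hq) (zpow_ne_zero _ hκ) (fun m m' h => by
      rw [← zpow_mul, ← zpow_mul] at h
      obtain ⟨h1, h2⟩ := hgen _ _ h
      exact ⟨(mul_eq_zero.mp h1).resolve_left hn', (mul_eq_zero.mp h2).resolve_left hn'⟩)
  rw [isUnit_iff_ne_zero]
  intro hdet
  obtain ⟨v, hv0, hv⟩ := Matrix.exists_mulVec_eq_zero_iff.mpr hdet
  refine hv0 (hker v fun i => ?_)
  have h1 := congrFun hv i
  have hqr : ∀ n : ℤ, q ^ n = 1 → n = 0 := fun n h => (hgen n 0 (by simpa using h)).1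
  have h2 : q - q⁻¹ ≠ 0 := by simpa using pow_sub_inv_ne_zero hqr hq one_pos
  have h3 := cpow_half_zpow_ne hq hk hn
  have h4 : (n : ℂ) ≠ 0 := by exact_mod_cast hn.ne'
  simp only [Matrix.mulVec, dotProduct, heisMatrix, Matrix.of_apply, Pi.zero_apply] at h1
  rw [← mul_right_inj' (mul_ne_zero (mul_ne_zero h4 h2) (div_ne_zero h2 h3)), Finset.mul_sum,
    mul_zero] at h1
  rw [← h1]
  refine Finset.sum_congr rfl fun j _ => ?_
  rw [heisConst, qint, ← zpow_mul, ← zpow_mul, ← zpow_mul, mul_neg, mul_neg, neg_mul,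
    mul_comm (n : ℤ) (X.symm i j)]
  generalize (q ^ (k / 2)) ^ (2 * (n : ℤ)) - (q ^ (k / 2)) ^ (-(2 * (n : ℤ))) = y at h3
  generalize q - q⁻¹ = z at h2
  push_cast
  field_simp

section Dual

variable {X : AffineType} {q κ k l : ℂ} {V : Type*} [AddCommGroup V] [Module ℂ V]
  [Module (U X q κ) V] [IsScalarTower ℂ (U X q κ) V]

variable (X q κ V) in
/-- The creation operators `a_{i,-n}`, `n ≥ 1`. -/
noncomputable def creationOp (p : X.Node × ℕ) : Module.End ℂ V :=
  aOp X q κ V p.1 (-((p.2 + 1 : ℕ) : ℤ))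

variable (X q κ k V) in
/-- The annihilation operators dual to the creation operators. -/
noncomputable def annihilationOp (p : X.Node × ℕ) : Module.End ℂ V :=
  ∑ j, (heisMatrix X q κ k (p.2 + 1))⁻¹ p.1 j • aOp X q κ V j ((p.2 + 1 : ℕ) : ℤ)

theorem creationOp_commute (hV : InCategory X q κ k l V) (hq : q ≠ 0)
    (hqr : ∀ n : ℤ, q ^ n = 1 → n = 0) (p p' : X.Node × ℕ) :
    Commute (creationOp X q κ V p) (creationOp X q κ V p') :=
  aOp_commute_of_sign hV hq hqr _ _ (by omega)

theorem annihilationOp_commute (hV : InCategory X q κ k l V) (hq : q ≠ 0)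
    (hqr : ∀ n : ℤ, q ^ n = 1 → n = 0) (p p' : X.Node × ℕ) :
    Commute (annihilationOp X q κ k V p) (annihilationOp X q κ k V p') :=
  Commute.sum_left _ _ _ fun _ _ => Commute.sum_right _ _ _ fun _ _ =>
    ((show Commute _ _ from aOp_commute_of_sign hV hq hqr _ _ (by omega)).smul_left _).smul_right _

/-- Multiplying the positive modes by the inverse of the commutator matrix turns the Heisenberg
relations into canonical ones. -/
theorem annihilationOp_mul_creationOp (hV : InCategory X q κ k l V) (hq : q ≠ 0) (hκ : κ ≠ 0)
    (hgen : ∀ m n : ℤ, q ^ m * κ ^ n = 1 → m = 0 ∧ n = 0)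
    (hk : ∀ n : ℕ, 0 < n → (q ^ (2 * k)) ^ n ≠ 1) (p p' : X.Node × ℕ) :
    annihilationOp X q κ k V p * creationOp X q κ V p' =
      creationOp X q κ V p' * annihilationOp X q κ k V p + if p = p' then 1 else 0 := by
  have hqr : ∀ n : ℤ, q ^ n = 1 → n = 0 := fun n h => (hgen n 0 (by simpa using h)).1
  obtain ⟨i, m⟩ := p
  obtain ⟨i', m'⟩ := p'
  simp only [annihilationOp, creationOp, Finset.sum_mul, Finset.mul_sum, smul_mul_assoc,
    mul_smul_comm]
  by_cases hm : m = m'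
  · subst hm
    have h (j : X.Node) : aOp X q κ V j ((m + 1 : ℕ) : ℤ) * aOp X q κ V i' (-((m + 1 : ℕ) : ℤ)) =
        aOp X q κ V i' (-((m + 1 : ℕ) : ℤ)) * aOp X q κ V j ((m + 1 : ℕ) : ℤ) +
          heisMatrix X q κ k (m + 1) j i' • 1 := by
      rw [aOp_mul_aOp hV hq hqr _ _ (by omega) (by omega), if_pos (by omega)]
      rfl
    simp only [h, smul_add, Finset.sum_add_distrib, smul_smul, ← Finset.sum_smul]
    congr 1
    have hinv := congrFun (congrFun (Matrix.nonsing_inv_mul _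
      (isUnit_det_heisMatrix X hq hκ hgen hk (Nat.succ_pos m))) i) i'
    rw [Matrix.mul_apply, Matrix.one_apply] at hinv
    rw [hinv]
    by_cases hi : i = i'
    · simp [hi]
    · simp [hi]
  · rw [if_neg (fun h => hm (Prod.ext_iff.mp h).2), add_zero]
    exact Finset.sum_congr rfl fun j _ => by
      rw [aOp_commute_of_sign hV hq hqr _ _ (by omega)]

theorem mem_vacuumSpace {v : V} :
    v ∈ vacuumSpace X q κ V ↔ ∀ i (m : ℤ), 0 < m → aOp X q κ V i m v = 0 := by
  simp [vacuumSpace, Submodule.mem_iInf]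

/-- For each n the new annihilation operators are an invertible combination of the a_{j,n}, so both
families have the same common kernel. -/
theorem mem_vacuumSpace_iff_annihilationOp (hq : q ≠ 0) (hκ : κ ≠ 0)
    (hgen : ∀ m n : ℤ, q ^ m * κ ^ n = 1 → m = 0 ∧ n = 0)
    (hk : ∀ n : ℕ, 0 < n → (q ^ (2 * k)) ^ n ≠ 1) {v : V} :
    v ∈ vacuumSpace X q κ V ↔ ∀ p, annihilationOp X q κ k V p v = 0 := by
  rw [mem_vacuumSpace]
  constructor
  · intro h p
    rw [annihilationOp, LinearMap.sum_apply]
    exact Finset.sum_eq_zero fun j _ => by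
      rw [LinearMap.smul_apply, h j _ (by omega), smul_zero]
  · intro h i m hm
    obtain ⟨n, rfl⟩ : ∃ n : ℕ, m = ((n + 1 : ℕ) : ℤ) := ⟨(m - 1).toNat, by omega⟩
    have h1 : ∑ j, heisMatrix X q κ k (n + 1) i j • annihilationOp X q κ k V (j, n) v = 0 :=
      Finset.sum_eq_zero fun j _ => by rw [h, smul_zero]
    simp only [annihilationOp, LinearMap.sum_apply, LinearMap.smul_apply, Finset.smul_sum,
      smul_smul] at h1
    rw [Finset.sum_comm] at h1
    simp only [← Finset.sum_smul, ← Matrix.mul_apply, Matrix.mul_nonsing_inv _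
      (isUnit_det_heisMatrix X hq hκ hgen hk (Nat.succ_pos n)), Matrix.one_apply, ite_smul,
      one_smul, zero_smul, Finset.sum_ite_eq, Finset.mem_univ, if_true] at h1
    exact h1

theorem annihilationOp_mem_shiftSpace (hq : q ≠ 0) (p : X.Node × ℕ) :
    annihilationOp X q κ k V p ∈ shiftSpace X q κ V ((p.2 + 1 : ℕ) : ℤ) :=
  Submodule.sum_mem _ fun j _ => Submodule.smul_mem _ _ (aOp_mem_shiftSpace hq j _)

theorem annihilationOp_nilpotent (hV : InCategory X q κ k l V) (hq : q ≠ 0) (p : X.Node × ℕ)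
    (v : V) : ∃ n, (annihilationOp X q κ k V p ^ n) v = 0 := by
  have hv : v ∈ ⨆ ω : ℂ, degreeSpace X q κ V ω := hV.graded ▸ Submodule.mem_top
  induction hv using Submodule.iSup_induction' with
  | zero => exact ⟨0, map_zero _⟩
  | add v w _ _ hv hw =>
    obtain ⟨m, hm⟩ := hv
    obtain ⟨n, hn⟩ := hw
    refine ⟨m + n, ?_⟩
    rw [map_add, pow_add, Module.End.mul_apply, Module.End.mul_apply, hn, map_zero, add_zero,
      ← Module.End.mul_apply, ← pow_add, add_comm, pow_add, Module.End.mul_apply, hm, map_zero]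
  | mem ω v hv =>
    obtain ⟨n₀, h₀⟩ := exists_forall_degreeSpace_eq_bot hV ω
    have hpow (n : ℕ) : annihilationOp X q κ k V p ^ n ∈
        shiftSpace X q κ V ((n * (p.2 + 1) : ℕ) : ℤ) := by
      induction n with
      | zero => simpa using one_mem_shiftSpace
      | succ n ih =>
        rw [pow_succ, Nat.succ_mul, Nat.cast_add]
        exact mul_mem_shiftSpace ih (annihilationOp_mem_shiftSpace hq p)
    -- Each application raises the degree by at least 1, so n₀ + 1 of them pass the cutoff.
    refine ⟨n₀ + 1, ?_⟩
    have h := hpow (n₀ + 1) ω v hv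
    rwa [h₀ _ (by
      have : n₀ + 1 ≤ (n₀ + 1) * (p.2 + 1) := Nat.le_mul_of_pos_right _ (Nat.succ_pos _)
      omega), Submodule.mem_bot] at h

theorem annihilationOp_finite (hV : InCategory X q κ k l V) (hq : q ≠ 0) (v : V) :
    {p | annihilationOp X q κ k V p v ≠ 0}.Finite := by
  have hv : v ∈ ⨆ ω : ℂ, degreeSpace X q κ V ω := hV.graded ▸ Submodule.mem_top
  induction hv using Submodule.iSup_induction' with
  | zero => simp
  | add v w _ _ hv hw =>
    refine (hv.union hw).subset fun p hp => ?_
    by_contra h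
    simp only [Set.mem_union, Set.mem_ofPred_eq, not_or, not_not] at h
    exact hp (by rw [map_add, h.1, h.2, add_zero])
  | mem ω v hv =>
    obtain ⟨n₀, h₀⟩ := exists_forall_degreeSpace_eq_bot hV ω
    refine (Set.finite_univ.prod (Set.finite_Iic n₀)).subset fun p hp => ⟨trivial, ?_⟩
    by_contra hlt
    have hlt' : n₀ < p.2 := by simpa using hlt
    have h := annihilationOp_mem_shiftSpace (k := k) (V := V) (κ := κ) hq p ω v hv
    rw [h₀ _ (by omega), Submodule.mem_bot] at h
    exact hp h

/-- A nonzero subspace stable under `q^d` and the Heisenberg operators has a nonzero vacuum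
vector. -/
theorem exists_vacuum_mem (hV : InCategory X q κ k l V) (hq : q ≠ 0) (hq1 : q ≠ 1)
    {N : Submodule ℂ V} (hd : ∀ v ∈ N, act X q κ V (gen .qd) v ∈ N)
    (hN : ∀ i m, ∀ v ∈ N, aOp X q κ V i m v ∈ N) (hne : N ≠ ⊥) :
    ∃ v ∈ N, v ≠ 0 ∧ v ∈ vacuumSpace X q κ V := by
  by_contra! hcon
  refine hne (le_bot_iff.mp (le_of_degree_le hV hq hq1 hd fun ω v hv hvω => ?_))
  obtain ⟨n₀, h₀⟩ := exists_forall_degreeSpace_eq_bot hV ω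
  -- Downward induction on the degree: positive modes send a homogeneous vector of N to higher
  -- degree, where N is already zero, so that vector would be a vacuum vector.
  have key (A : ℕ) : ∀ j : ℤ, n₀ - j < A → ∀ v ∈ N, v ∈ degreeSpace X q κ V (ω + j) →
      v = 0 := by
    induction A with
    | zero =>
      intro j hj v _ hvj
      rwa [h₀ j (by push_cast at hj; omega), Submodule.mem_bot] at hvj
    | succ A ih =>
      intro j hj v hv hvj
      by_contra hv0
      refine hcon v hv hv0 (mem_vacuumSpace.mpr fun i m hm => ?_)
      refine ih (j + m) (by push_cast at hj; omega) _ (hN i m v hv) ?_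
      have := aOp_mem_shiftSpace (V := V) (κ := κ) hq i m _ _ hvj
      rwa [add_assoc, ← Int.cast_add] at this
  exact (Submodule.mem_bot ℂ).mpr (key (n₀ + 1) 0 (by simp) v hv (by simpa using hvω))

/-! ### Submodules of the vacuum space -/

theorem zAlgebra_mem_vacuumSpace (hV : InCategory X q κ k l V) (hq : q ≠ 0)
    (hqr : ∀ n : ℤ, q ^ n = 1 → n = 0) (hk : ∀ n : ℕ, 0 < n → (q ^ (2 * k)) ^ n ≠ 1)
    {T : Module.End ℂ V} (hT : T ∈ zAlgebra X q κ k V) :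
    ∀ v ∈ vacuumSpace X q κ V, T v ∈ vacuumSpace X q κ V := by
  refine apply_mem_of_mem_adjoin ?_ hT
  rintro _ ((⟨ε, i, m, rfl⟩ | ⟨i, rfl | rfl⟩) | rfl) v hv <;>
    rw [mem_vacuumSpace] at hv ⊢ <;> intro j n hn
  · rw [aOp_zOp hV hq hqr hk, hv j n hn, map_zero]
  · rw [← Module.End.mul_apply, ← k_mul_aOp, Module.End.mul_apply, hv j n hn, map_zero]
  · rw [← Module.End.mul_apply, ← kInv_mul_aOp, Module.End.mul_apply, hv j n hn, map_zero]
  · have h := LinearMap.congr_fun (qd_mul_aOp (V := V) (q := q) (κ := κ) j n) v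
    rw [Module.End.mul_apply, hv j n hn, map_zero, LinearMap.smul_apply,
      Module.End.mul_apply] at h
    exact (smul_eq_zero.mp h.symm).resolve_left (zpow_ne_zero _ hq)

/-- A subspace stable under the operators of `Z_V`, as a submodule. -/
noncomputable def zSubmodule (N : Submodule ℂ V)
    (h : ∀ T ∈ zAlgebra X q κ k V, ∀ v ∈ N, T v ∈ N) : Submodule (zAlgebra X q κ k V) V where
  carrier := N
  add_mem' := N.add_mem
  zero_mem' := N.zero_mem
  smul_mem' := fun T v hv => h T.1 T.2 v hv

theorem zOp_mem_zAlgebra (ε : ℤˣ) (i : X.Node) (m : ℤ) :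
    zOp X q κ k V ε i m ∈ zAlgebra X q κ k V :=
  Algebra.subset_adjoin (Or.inl (Or.inl ⟨ε, i, m, rfl⟩))

theorem k_mem_zAlgebra (i : X.Node) : act X q κ V (gen (.k i)) ∈ zAlgebra X q κ k V :=
  Algebra.subset_adjoin (Or.inl (Or.inr ⟨i, Or.inl rfl⟩))

theorem kInv_mem_zAlgebra (i : X.Node) : act X q κ V (gen (.kInv i)) ∈ zAlgebra X q κ k V :=
  Algebra.subset_adjoin (Or.inl (Or.inr ⟨i, Or.inr rfl⟩))

theorem qd_mem_zAlgebra : act X q κ V (gen .qd) ∈ zAlgebra X q κ k V :=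
  Algebra.subset_adjoin (Or.inr rfl)

/-- The generators of Z_V include q^d but not its inverse. Stability under the inverse follows
because N is spanned by homogeneous vectors. -/
theorem qdInv_mem (hV : InCategory X q κ k l V) (hq : q ≠ 0) (hq1 : q ≠ 1) {N : Submodule ℂ V}
    (hd : ∀ v ∈ N, act X q κ V (gen .qd) v ∈ N) :
    ∀ v ∈ N, act X q κ V (gen .qdInv) v ∈ N := by
  refine le_of_degree_le (M := N.comap (act X q κ V (gen .qdInv))) hV hq hq1 hd
    fun ω v hv hvω => ?_
  have hω : q ^ ω ≠ 0 := by simp [Complex.cpow_eq_zero_iff, hq]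
  have h := act_qdInv_qd (X := X) (q := q) (κ := κ) v
  rw [mem_degreeSpace.mp hvω, map_smul] at h
  rw [Submodule.mem_comap, ← inv_smul_smul₀ hω (act X q κ V (gen .qdInv) v), h]
  exact N.smul_mem _ hv

/-- A subspace stable under `Z_V` and the Heisenberg operators is stable under `U`. -/
theorem gen_mem_of_zAlgebra_mem (hV : InCategory X q κ k l V) (hq : q ≠ 0)
    (hqr : ∀ n : ℤ, q ^ n = 1 → n = 0) {N : Submodule ℂ V}
    (hZ : ∀ T ∈ zAlgebra X q κ k V, ∀ v ∈ N, T v ∈ N)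
    (hN : ∀ i m, ∀ v ∈ N, aOp X q κ V i m v ∈ N) (g : Gen X) :
    ∀ v ∈ N, act X q κ V (gen g) v ∈ N := by
  have hq1 : q ≠ 1 := fun h => by
    have := hqr 1 (by simpa using h)
    omega
  have hqd := hZ _ qd_mem_zAlgebra
  intro v hv
  cases g with
  | a i m hm =>
    have h := N.smul_mem (qint q (X.d i))⁻¹ (hN i m v hv)
    have hd : qint q (X.d i) ≠ 0 := by
      have h1 := pow_sub_inv_ne_zero hqr hq (X.d_pos i)
      have h2 := pow_sub_inv_ne_zero hqr hq one_pos
      rw [pow_one] at h2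
      rw [qint, zpow_neg, zpow_natCast]
      exact div_ne_zero h1 h2
    rw [aOp, LinearMap.smul_apply, inv_smul_smul₀ hd, aFree, dif_pos hm] at h
    exact h
  | x ε i n =>
    exact x_mem_of_zOp_mem hV hq hq1 hqd hN (fun m => hZ _ (zOp_mem_zAlgebra ε i m)) n v hv
  | k i => exact hZ _ (k_mem_zAlgebra i) v hv
  | kInv i => exact hZ _ (kInv_mem_zAlgebra i) v hv
  | qc =>
    have h := act_qcPow hV hq 1
    rw [show qcPow (X := X) 1 = gen .qc from pow_one _] at h
    rw [h]
    exact N.smul_mem _ hv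
  | qcInv =>
    have h := act_qcPow hV hq (-1)
    rw [show qcPow (X := X) (-1) = gen .qcInv from pow_one _] at h
    rw [h]
    exact N.smul_mem _ hv
  | qd => exact hqd v hv
  | qdInv => exact qdInv_mem hV hq hq1 hqd v hv

theorem zAlgebra_mem_of_gen_mem (hV : InCategory X q κ k l V) (hq : q ≠ 0) {N : Submodule ℂ V}
    (hN : ∀ x : Free X, ∀ v ∈ N, act X q κ V x v ∈ N) :
    ∀ T ∈ zAlgebra X q κ k V, ∀ v ∈ N, T v ∈ N := by
  intro T hT
  refine apply_mem_of_mem_adjoin ?_ hT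
  rintro _ ((⟨ε, i, m, rfl⟩ | ⟨i, rfl | rfl⟩) | rfl)
  · exact zOp_mem_of_x_mem hV hq (fun i m v hv => N.smul_mem _ (hN _ v hv)) (fun n => hN _) m
  all_goals exact hN _

/-- A subspace stable under the creation operators and containing the vacuum space is everything. -/
theorem eq_top_of_vacuumSpace_le (hV : InCategory X q κ k l V) (hq : q ≠ 0) (hκ : κ ≠ 0)
    (hgen : ∀ m n : ℤ, q ^ m * κ ^ n = 1 → m = 0 ∧ n = 0)
    (hk : ∀ n : ℕ, 0 < n → (q ^ (2 * k)) ^ n ≠ 1) {N : Submodule ℂ V}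
    (hN : ∀ i m, ∀ v ∈ N, aOp X q κ V i m v ∈ N) (hvac : vacuumSpace X q κ V ≤ N) : N = ⊤ := by
  have hqr : ∀ n : ℤ, q ^ n = 1 → n = 0 := fun n h => (hgen n 0 (by simpa using h)).1
  refine eq_top_of_vacuum_le (a := creationOp X q κ V) (b := annihilationOp X q κ k V)
    (annihilationOp_commute hV hq hqr) (fun p p' hp => ?_) (fun p => ?_)
    (annihilationOp_nilpotent hV hq) (annihilationOp_finite hV hq) (fun p => hN _ _)
    (fun v hv => hvac ((mem_vacuumSpace_iff_annihilationOp hq hκ hgen hk).mpr hv))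
  · have h := annihilationOp_mul_creationOp (V := V) hV hq hκ hgen hk p p'
    rwa [if_neg hp, add_zero] at h
  · rw [annihilationOp_mul_creationOp hV hq hκ hgen hk, if_pos rfl]

/-- If a subspace `W` of the vacuum space generates everything under the creation operators, it
is the vacuum space. -/
theorem vacuumSpace_le_of_creationSpan (hV : InCategory X q κ k l V) (hq : q ≠ 0) (hκ : κ ≠ 0)
    (hgen : ∀ m n : ℤ, q ^ m * κ ^ n = 1 → m = 0 ∧ n = 0)
    (hk : ∀ n : ℕ, 0 < n → (q ^ (2 * k)) ^ n ≠ 1) {W : Submodule ℂ V}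
    (hW : W ≤ vacuumSpace X q κ V) (htop : creationSpan (creationOp X q κ V) W = ⊤) :
    vacuumSpace X q κ V ≤ W := by
  have hqr : ∀ n : ℤ, q ^ n = 1 → n = 0 := fun n h => (hgen n 0 (by simpa using h)).1
  intro v hv
  have hv' := creationSpan_le_sup_range (htop ▸ Submodule.mem_top : v ∈ _)
  -- A vacuum vector splits as w + u with w in W and u in the sum of the images of the creation
  -- operators; u is then a vacuum vector as well, hence zero.
  obtain ⟨w, hw, u, hu, rfl⟩ := Submodule.mem_sup.mp hv'
  have hu' : u ∈ vacuumSpace X q κ V := by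
    simpa using Submodule.sub_mem _ hv (hW hw)
  rw [eq_zero_of_vacuum_of_mem_iSup_range (b := annihilationOp X q κ k V)
    (creationOp_commute hV hq hqr) (fun p p' hp => ?_) (fun p => ?_)
    (annihilationOp_nilpotent hV hq) hu
    ((mem_vacuumSpace_iff_annihilationOp hq hκ hgen hk).mp hu'), add_zero]
  · exact hw
  · have h := annihilationOp_mul_creationOp (V := V) hV hq hκ hgen hk p p'
    rwa [if_neg hp, add_zero] at h
  · rw [annihilationOp_mul_creationOp hV hq hκ hgen hk, if_pos rfl]

/-! ### Stability of the span generated from a subspace of the vacuum -/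

section Span

variable {W : Submodule ℂ V}

/-- A positive mode passes each creation operator up to a scalar and finally kills W. -/
theorem aOp_mem_creationSpan (hV : InCategory X q κ k l V) (hq : q ≠ 0)
    (hqr : ∀ n : ℤ, q ^ n = 1 → n = 0) (hW : W ≤ vacuumSpace X q κ V) (i : X.Node) (m : ℤ) :
    ∀ v ∈ creationSpan (creationOp X q κ V) W,
      aOp X q κ V i m v ∈ creationSpan (creationOp X q κ V) W := by
  rcases lt_trichotomy m 0 with hm | rfl | hm
  · obtain ⟨n, rfl⟩ : ∃ n : ℕ, m = -((n + 1 : ℕ) : ℤ) := ⟨(-m - 1).toNat, by omega⟩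
    exact apply_mem_creationSpan (i, n)
  · intro v _
    rw [aOp_zero]
    exact Submodule.zero_mem _
  · refine mem_creationSpan_of_commutator (fun w hw => ?_) fun p v hv hT => ?_
    · rw [mem_vacuumSpace.mp (hW hw) i m hm]
      exact Submodule.zero_mem _
    · rw [← Module.End.mul_apply, creationOp, aOp_mul_aOp hV hq hqr _ _ hm.ne' (by omega),
        LinearMap.add_apply]
      refine Submodule.add_mem _ (apply_mem_creationSpan p _ hT) ?_
      split_ifs
      · exact Submodule.smul_mem _ _ hv
      · exact Submodule.zero_mem _

/-- The generators of Z_V commute with the creation operators, q^d up to a scalar, so stability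
passes from W to the span. -/
theorem zAlgebra_mem_creationSpan (hV : InCategory X q κ k l V) (hq : q ≠ 0)
    (hqr : ∀ n : ℤ, q ^ n = 1 → n = 0) (hk : ∀ n : ℕ, 0 < n → (q ^ (2 * k)) ^ n ≠ 1)
    (hZ : ∀ T ∈ zAlgebra X q κ k V, ∀ v ∈ W, T v ∈ W) :
    ∀ T ∈ zAlgebra X q κ k V, ∀ v ∈ creationSpan (creationOp X q κ V) W,
      T v ∈ creationSpan (creationOp X q κ V) W := by
  intro T hT
  refine apply_mem_of_mem_adjoin ?_ hT
  rintro S hS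
  refine mem_creationSpan_of_commutator
    (fun w hw => le_creationSpan (hZ S (Algebra.subset_adjoin hS) w hw)) fun p v _ hv => ?_
  have hp := apply_mem_creationSpan (a := creationOp X q κ V) (W := W) p _ hv
  rcases hS with ((⟨ε, i, m, rfl⟩ | ⟨i, rfl | rfl⟩) | rfl)
  · rw [creationOp, ← aOp_zOp hV hq hqr hk]
    exact hp
  · rw [← Module.End.mul_apply, creationOp, k_mul_aOp]
    exact hp
  · rw [← Module.End.mul_apply, creationOp, kInv_mul_aOp]
    exact hp
  · rw [← Module.End.mul_apply, creationOp, qd_mul_aOp]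
    exact Submodule.smul_mem _ _ hp

end Span

end Dual

end QToroidal

/-! ### Irreducibility of V and of the vacuum space -/

open QToroidal in
theorem mainTheorem8 (X : QToroidal.AffineType) (q κ : ℂ) (hq : q ≠ 0) (hκ : κ ≠ 0)
    (hgen : ∀ m n : ℤ, q ^ m * κ ^ n = 1 → m = 0 ∧ n = 0)
    (k l : ℂ) (hk : ∀ n : ℕ, 0 < n → (q ^ (2 * k)) ^ n ≠ 1)
    (V : Type*) [AddCommGroup V] [Module ℂ V] [Module (QToroidal.U X q κ) V]
    [IsScalarTower ℂ (QToroidal.U X q κ) V] (hV : QToroidal.InCategory X q κ k l V) :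
    (∀ (ε : ℤˣ) (i : X.Node) (m : ℤ) (v : V),
      {p : ℕ × ℕ | QToroidal.zTerm X q κ k V ε i m p v ≠ 0}.Finite) ∧
    ∃ Ω : Submodule (QToroidal.zAlgebra X q κ k V) V,
      (Ω : Set V) = (QToroidal.vacuumSpace X q κ V : Set V) ∧
      (IsSimpleModule (QToroidal.U X q κ) V ↔
        IsSimpleModule (QToroidal.zAlgebra X q κ k V) Ω) := by
  have hqr : ∀ n : ℤ, q ^ n = 1 → n = 0 := fun n h => (hgen n 0 (by simpa using h)).1
  have hq1 : q ≠ 1 := fun h => by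
    have := hqr 1 (by simpa using h)
    omega
  have hΩ : ∀ T ∈ zAlgebra X q κ k V, ∀ v ∈ vacuumSpace X q κ V, T v ∈ vacuumSpace X q κ V :=
    fun T hT => zAlgebra_mem_vacuumSpace hV hq hqr hk hT
  refine ⟨zTerm_finite hV hq, zSubmodule _ hΩ, rfl, ?_⟩
  rw [isSimpleModule_iff_isAtom, isSimpleModule_iff]
  constructor
  · intro hsimple
    have hnt : (⊤ : Submodule ℂ V) ≠ ⊥ := by
      intro h
      refine top_ne_bot (α := Submodule (U X q κ) V) (le_bot_iff.mp fun v _ => ?_)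
      exact (Submodule.mem_bot ℂ).mp (h ▸ Submodule.mem_top : v ∈ (⊥ : Submodule ℂ V))
    constructor
    · intro h
      obtain ⟨v, _, hv0, hv⟩ := exists_vacuum_mem hV hq hq1 (N := ⊤) (fun _ _ => trivial)
        (fun _ _ _ _ => trivial) hnt
      have hv' : v ∈ zSubmodule _ hΩ := hv
      rw [h] at hv'
      exact hv0 ((Submodule.mem_bot _).mp hv')
    · intro W' hW'
      by_contra hne
      set W : Submodule ℂ V := W'.restrictScalars ℂ with hWdef
      have hW : W ≤ vacuumSpace X q κ V := hW'.le
      have hZ : ∀ T ∈ zAlgebra X q κ k V, ∀ v ∈ W, T v ∈ W :=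
        fun T hT v hv => W'.smul_mem ⟨T, hT⟩ hv
      -- The span generated from W is a nonzero U-submodule, hence all of V; this forces W to be the
      -- whole vacuum space.
      set M := submoduleOfGen _ (gen_mem_of_zAlgebra_mem hV hq hqr
        (zAlgebra_mem_creationSpan hV hq hqr hk hZ) (aOp_mem_creationSpan hV hq hqr hW))
      have hM : M ≠ ⊥ := by
        obtain ⟨w, hw, hw0⟩ := Submodule.exists_mem_ne_zero_of_ne_bot hne
        intro h
        exact hw0 ((Submodule.mem_bot (U X q κ)).mp (h ▸ (le_creationSpan hw : w ∈ M)))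
      have htop : creationSpan (creationOp X q κ V) W = ⊤ := by
        rw [eq_top_iff]
        intro v _
        exact ((eq_bot_or_eq_top M).resolve_left hM ▸ Submodule.mem_top : v ∈ M)
      exact hW'.not_ge (vacuumSpace_le_of_creationSpan hV hq hκ hgen hk hW htop)
  · intro hatom
    obtain ⟨w, hw, hw0⟩ := Submodule.exists_mem_ne_zero_of_ne_bot hatom.1
    have : Nontrivial V := ⟨w, 0, hw0⟩
    refine { eq_bot_or_eq_top := fun N' => or_iff_not_imp_left.mpr fun hne => ?_ }
    set N : Submodule ℂ V := N'.restrictScalars ℂ with hNdef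
    have hN : ∀ x : Free X, ∀ v ∈ N, act X q κ V x v ∈ N := fun x v hv =>
      N'.smul_mem (RingQuot.mkAlgHom ℂ (Rel X q κ) x) hv
    have haN : ∀ i m, ∀ v ∈ N, aOp X q κ V i m v ∈ N :=
      fun i m v hv => N.smul_mem _ (hN _ v hv)
    have hN0 : N ≠ ⊥ := fun h => hne (by
      rw [Submodule.eq_bot_iff] at h ⊢
      exact h)
    obtain ⟨v, hv, hv0, hvac⟩ := exists_vacuum_mem hV hq hq1 (hN _) haN hN0
    -- N is also a Z_V-submodule and meets the vacuum space nontrivially; the vacuum space being an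
    -- atom, it lies in N.
    have hle : zSubmodule _ hΩ ≤ zSubmodule N (zAlgebra_mem_of_gen_mem hV hq hN) :=
      hatom.not_disjoint_iff_le.mp fun hdis =>
        hv0 (Submodule.disjoint_def.mp hdis v hvac hv)
    have htop := eq_top_of_vacuumSpace_le hV hq hκ hgen hk haN hle
    rw [eq_top_iff]
    intro v _
    exact (htop ▸ Submodule.mem_top : v ∈ N)
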